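/- **Setting.** Fix an inverse temperature $\beta>0$ and a finite set $J$ of coupling indices. All operators are given as (possibly infinite) matrices in an orthonormal energy basis. *System.* $H_S=\sum_i\omega_i|\omega_i\rangle\langle\omega_i|$, $i\in I$, with $I$ a finite or infinite index set, has pairwise distinct (non-degenerate) levels $\omega_i$, and $\sum_i e^{-\beta\omega_i}<\infty$. The couplings $L_n$ $(n\in J)$ are Hermitian matrices, possibly unbounded, with $\sum_k|\langle\omega_k|L_n|\omega_j\rangle|^2<\infty$ for all $n,j$. Put $\rho_S=e^{-\beta H_S}/\mathrm{Tr}\,e^{-\beta H_S}$. *Reservoir.* It is the limit $N\to\infty$ of environments with discrete levels $\varepsilon^N_\mu$, $\sum_\mu e^{-\beta\varepsilon^N_\mu}<\infty$, and Hermitian couplings $l^N_n$ with thermal mean $\langle l^N_n\rangle_E=0$ and $\sum_{\mu\nu}e^{-\beta\varepsilon^N_\mu}|(l^N_n)_{\mu\nu}|^2<\infty$. With $l_n(t)=e^{itH_E}l_ne^{-itH_E}$ and $\langle\cdot\rangle_E$ the thermal average, the correlation functions $\langle l^N_n(t)\,l^N_m(s)\rangle_E$ converge for all real $t,s$ to $\alpha_{nm}(t-s)$,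 where $\alpha_{nm}$ is continuous and decays in the sense that $\alpha_{nm}\in L^1(\mathbb R)$. Write $\tilde\alpha(w)=\int e^{-iwt}\alpha(t)\,dt$. *Master equation.* Let $$(A_{nm}\diamond L_m)(t)=\int_0^t\alpha_{nm}(t-s)\,e^{-i(t-s)H_S}L_m e^{i(t-s)H_S}\,ds .$$ Let $A_{nm}\diamond L_m$ (without $t$) be the matrix with elements $A_{nm}(\omega_i-\omega_k)\langle\omega_i|L_m|\omega_k\rangle$, where $A_{nm}(w)=\int_0^\infty e^{-iw\tau}\alpha_{nm}(\tau)\,d\tau$. Put $\mathcal L_0\rho=-i[H_S,\rho]$ and $$\mathcal L_2\rho=\sum_{n,m}\big[L_n,\ \rho\,(A_{nm}\diamond L_m)^\dagger-(A_{nm}\diamond L_m)\,\rho\big].$$ A matrix $\rho_2$ is called a *second-order stationary correction* of $\rho_S$ if $\mathcal L_0\rho_S=0$ and $\mathcal L_0\rho_2+\mathcal L_2\rho_S=0$, i.e. $(\mathcal L_0+g^2\mathcal L_2)(\rho_S+g^2\rho_2)=O(g^4)$. Its diagonal is left undetermined. *Closed system.* $H_C(g)=H_S\otimes 1+1\otimes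 H_E+g\sum_nL_n\otimes l_n$. The reduced thermal state $\mathrm{Tr}_E[e^{-\beta H_C(g)}]/Z_C(g)$, with $Z_C(g)=\mathrm{Tr}\,e^{-\beta H_C(g)}$, is expanded as a formal power series in $g$. Here $e^{-\beta H_C(g)}$ is expanded in its Dyson series, i.e. the solution, order by order in $g$, of $\partial_tT=-H_C(g)T$, $T(0)=1$, at $t=\beta$. Let $r^{N,k}_{ij}$ be the coefficient of $g^k$ in the $(i,j)$ energy-basis element for the $N$-th environment. (A coefficient of $Z_C$ whose defining trace does not converge absolutely is read as $0$; the coefficients $r^{N,k}_{ij}$ with $k\le2$, $i\neq j$, do not depend on this.) **Claim.** 1. For all $n,m,i,k$, the $(i,k)$ element of $(A_{nm}\diamond L_m)(t)$ tends to that of $A_{nm}\diamond L_m$ as $t\to\infty$. 2. The multivariate KMS relations hold: $\tilde\alpha_{nm}(w)=\tilde\alpha_{mn}(-w)\,e^{-\beta w}$ and $\tilde\alpha_{mn}(-w)=\overline{\tilde\alpha_{nm}(-w)}$ for all $n,m$ and real $w$. 3. $\rho_S$ has a second-order stationary correction. 4. For every $N$ and all $i,j$: $r^{N,0}_{ij}=\langle\omega_i|\rho_S|\omega_j\rangle$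 and $r^{N,1}_{ij}=0$. 5. For every second-order stationary correction $\rho_2$ of $\rho_S$ and all $i\ne j$, $$\langle\omega_i|\rho_2|\omega_j\rangle=-i\,\frac{\langle\omega_i|\mathcal L_2\{\rho_S\}|\omega_j\rangle}{\omega_i-\omega_j}=\lim_{N\to\infty}r^{N,2}_{ij}.$$ So the second-order stationary state of the master equation and the reduced closed-system thermal state agree to second order in the interaction, in all off-diagonal elements that the second-order dynamics determines. 6. If the system and the $N$-th environment are finite-dimensional, the series is the Taylor expansion of the actual state: for all $i,j$, as $g\to0$, $$\langle\omega_i|\,\mathrm{Tr}_E[e^{-\beta H_C(g)}]/Z_C(g)\,|\omega_j\rangle=\sum_{k=0}^2r^{N,k}_{ij}g^k+O(g^3).$$ -/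

import Mathlib

open Filter Topology MeasureTheory Asymptotics

noncomputable section

namespace OpenSystem

/-!
Operators are written as (possibly infinite) matrices in an orthonormal energy basis; a coupling
operator may be unbounded.  All sums below are unconditional sums.
-/

/-- Operator product of two matrices over a possibly infinite index set.  On a finite index set
this is the usual matrix product. -/
def mmul {a : Type*} (X Y : Matrix a a ℂ) : Matrix a a ℂ :=
  fun i j => ∑' k, X i k * Y k j

/-- Commutator `[X, Y]`. -/
def comm {a : Type*} (X Y : Matrix a a ℂ) : Matrix a a ℂ := mmul X Y - mmul Y X

/-- Trace. -/
def tr {a : Type*} (X : Matrix a a ℂ) : ℂ := ∑' i, X i i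

/-- Partial trace over the environment factor of system times environment. -/
def trEnv {ι κ : Type*} (X : Matrix (ι × κ) (ι × κ) ℂ) : Matrix ι ι ℂ :=
  fun i j => ∑' μ, X (i, μ) (j, μ)

/-- The Hamiltonian with energy levels `E`, in its energy basis. -/
def ham {a : Type*} [DecidableEq a] (E : a → ℝ) : Matrix a a ℂ :=
  Matrix.diagonal fun i => (E i : ℂ)

/-- The unnormalised Boltzmann operator `e^{-tH}` of the Hamiltonian with energy levels `E`. -/
def boltzmann {a : Type*} [DecidableEq a] (E : a → ℝ) (t : ℝ) : Matrix a a ℂ :=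
  Matrix.diagonal fun i => (Real.exp (-(t * E i)) : ℂ)

/-- The thermal state `e^{-βH} / Tr e^{-βH}`. -/
def thermal {a : Type*} [DecidableEq a] (β : ℝ) (E : a → ℝ) : Matrix a a ℂ :=
  fun i j => boltzmann E β i j / tr (boltzmann E β)

/-! ### The environment -/

/-- Thermal expectation value `⟨X⟩ = Tr[e^{-βH} X] / Tr e^{-βH}`. -/
def thermalMean {κ : Type*} [DecidableEq κ] (β : ℝ) (ε : κ → ℝ) (X : Matrix κ κ ℂ) : ℂ :=
  tr (mmul (boltzmann ε β) X) / tr (boltzmann ε β)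

/-- Heisenberg evolution `e^{itH} X e^{-itH}` under the Hamiltonian with energy levels `ε`. -/
def heisenberg {κ : Type*} (ε : κ → ℝ) (t : ℝ) (X : Matrix κ κ ℂ) : Matrix κ κ ℂ :=
  fun μ ν => Complex.exp (Complex.I * t * ε μ) * X μ ν * Complex.exp (-(Complex.I * t * ε ν))

/-- The environment correlation function `⟨x(t) y(s)⟩` in the thermal state. -/
def envCorr {κ : Type*} [DecidableEq κ] (β : ℝ) (ε : κ → ℝ) (x y : Matrix κ κ ℂ) (t s : ℝ) : ℂ :=
  thermalMean β ε (mmul (heisenberg ε t x) (heisenberg ε s y))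

/-- Fourier transform `∫ e^{-iwt} f(t) dt`. -/
def fourierT (f : ℝ → ℂ) (w : ℝ) : ℂ := ∫ t : ℝ, Complex.exp (-(Complex.I * w * t)) * f t

/-! ### The second-order master equation -/

/-- Free propagation of a system operator over the time `t - s`:
`e^{-i(t-s)H} X e^{+i(t-s)H}`. -/
def freeProp {ι : Type*} (ω : ι → ℝ) (t s : ℝ) (X : Matrix ι ι ℂ) : Matrix ι ι ℂ :=
  heisenberg ω (-(t - s)) X

/-- The second-order operator `(A ⋄ L)(t) = ∫₀ᵗ α(t-s) G₀(t,s){L} ds` for the stationary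
correlation function `α`. -/
def diamond {ι : Type*} (ω : ι → ℝ) (α : ℝ → ℂ) (L : Matrix ι ι ℂ) (t : ℝ) : Matrix ι ι ℂ :=
  fun i k => ∫ s in (0 : ℝ)..t, α (t - s) * freeProp ω t s L i k

/-- The late-time second-order coefficient `A(w) = ∫₀^∞ e^{-iwτ} α(τ) dτ`. -/
def lateCoeff (α : ℝ → ℂ) (w : ℝ) : ℂ :=
  ∫ τ in Set.Ioi (0 : ℝ), Complex.exp (-(Complex.I * w * τ)) * α τ

/-- The late-time second-order operator: the Hadamard product
`⟨i|A ⋄ L|k⟩ = A(ω_i - ω_k) ⟨i|L|k⟩`. -/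
def lateDiamond {ι : Type*} (ω : ι → ℝ) (α : ℝ → ℂ) (L : Matrix ι ι ℂ) : Matrix ι ι ℂ :=
  fun i k => lateCoeff α (ω i - ω k) * L i k

/-- The zeroth-order Liouville operator `-i [H, ρ]`. -/
def liouville0 {ι : Type*} [DecidableEq ι] (ω : ι → ℝ) (ρ : Matrix ι ι ℂ) : Matrix ι ι ℂ :=
  (-Complex.I) • comm (ham ω) ρ

/-- The second-order Liouville operator
`Σ_{nm} [L_n, ρ (A_{nm} ⋄ L_m)† - (A_{nm} ⋄ L_m) ρ]`, where `AL n m` stands for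
`A_{nm} ⋄ L_m`. -/
def liouville2 {ι J : Type*} [Fintype J] (L : J → Matrix ι ι ℂ)
    (AL : J → J → Matrix ι ι ℂ) (ρ : Matrix ι ι ℂ) : Matrix ι ι ℂ :=
  ∑ n, ∑ m, comm (L n) (mmul ρ (AL n m).conjTranspose - mmul (AL n m) ρ)

/-- The late-time second-order Liouville operator of the master equation. -/
def lateLiouville2 {ι J : Type*} [Fintype J] (ω : ι → ℝ) (L : J → Matrix ι ι ℂ)
    (α : J → J → ℝ → ℂ) (ρ : Matrix ι ι ℂ) : Matrix ι ι ℂ :=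
  liouville2 L (fun n m => lateDiamond ω (α n m) (L m)) ρ

/-- `ρ₀ + g² ρ₂` is stationary for `𝓛₀ + g² 𝓛₂` through the order `g²`, where `g` is the
interaction strength. -/
def IsSecondOrderStationary {ι J : Type*} [DecidableEq ι] [Fintype J] (ω : ι → ℝ)
    (L : J → Matrix ι ι ℂ) (α : J → J → ℝ → ℂ) (ρ₀ ρ₂ : Matrix ι ι ℂ) : Prop :=
  liouville0 ω ρ₀ = 0 ∧ liouville0 ω ρ₂ + lateLiouville2 ω L α ρ₀ = 0

/-! ### The closed system -/

/-- The interaction Hamiltonian `H_I = Σ_n L_n ⊗ l_n`. -/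
def interaction {ι κ J : Type*} [Fintype J] (L : J → Matrix ι ι ℂ) (l : J → Matrix κ κ ℂ) :
    Matrix (ι × κ) (ι × κ) ℂ :=
  ∑ n, Matrix.kronecker (L n) (l n)

/-- The closed-system Hamiltonian `H_C = H_S ⊗ 1 + 1 ⊗ H_E + g H_I`. -/
def closedHam {ι κ J : Type*} [DecidableEq ι] [DecidableEq κ] [Fintype J]
    (ω : ι → ℝ) (ε : κ → ℝ) (L : J → Matrix ι ι ℂ) (l : J → Matrix κ κ ℂ) (g : ℝ) :
    Matrix (ι × κ) (ι × κ) ℂ :=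
  Matrix.kronecker (ham ω) 1 + Matrix.kronecker 1 (ham ε) + (g : ℂ) • interaction L l

/-- The coefficient of `g^k` in the perturbation (Dyson) expansion of `e^{-t(H + g V)}`, where `H`
has energy levels `E`: the solution, order by order, of the Bloch equation
`dT/dt = -(H + g V) T`, `T(0) = 1`. -/
def dyson {a : Type*} [DecidableEq a] (E : a → ℝ) (V : Matrix a a ℂ) : ℕ → ℝ → Matrix a a ℂ
  | 0, t => boltzmann E t
  | k + 1, t => fun x y =>
      -∫ s in (0 : ℝ)..t, (Real.exp (-((t - s) * E x)) : ℂ) * mmul V (dyson E V k s) x y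

/-- The perturbation series of `e^{-β H_C}` in powers of the interaction strength. -/
def closedGibbs {ι κ J : Type*} [DecidableEq ι] [DecidableEq κ] [Fintype J]
    (β : ℝ) (ω : ι → ℝ) (ε : κ → ℝ) (L : J → Matrix ι ι ℂ) (l : J → Matrix κ κ ℂ) (k : ℕ) :
    Matrix (ι × κ) (ι × κ) ℂ :=
  dyson (fun x : ι × κ => ω x.1 + ε x.2) (interaction L l) k β

/-- The perturbation series, in powers of the interaction strength, of the matrix element
`⟨i| Tr_E[e^{-β H_C}] / Z_C |j⟩` of the reduced closed-system thermal state. -/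
def reducedThermalSeries {ι κ J : Type*} [DecidableEq ι] [DecidableEq κ] [Fintype J]
    (β : ℝ) (ω : ι → ℝ) (ε : κ → ℝ) (L : J → Matrix ι ι ℂ) (l : J → Matrix κ κ ℂ) (i j : ι) :
    PowerSeries ℂ :=
  PowerSeries.mk (fun k => trEnv (closedGibbs β ω ε L l k) i j) *
    (PowerSeries.mk fun k => tr (closedGibbs β ω ε L l k))⁻¹

/-- The reduced closed-system thermal state `Tr_E[e^{-β H_C}] / Z_C` itself, with the matrix
exponential, for a finite-dimensional closed system. -/
def reducedThermal {ι κ J : Type*} [Fintype ι] [Fintype κ] [DecidableEq ι] [DecidableEq κ]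
    [Fintype J] (β : ℝ) (ω : ι → ℝ) (ε : κ → ℝ) (L : J → Matrix ι ι ℂ)
    (l : J → Matrix κ κ ℂ) (g : ℝ) : Matrix ι ι ℂ :=
  fun i j => trEnv (NormedSpace.exp (-((β : ℂ) • closedHam ω ε L l g))) i j /
    tr (NormedSpace.exp (-((β : ℂ) • closedHam ω ε L l g)))

end OpenSystem

end

/-!
The theorem rests on one statement about the reservoir.  In second order the closed system enters
through the spectral sums `spectralSum`, which are imaginary-time correlation functions of the
environment integrated over `[0, β]`; the master equation enters through half-line integrals of
real-time correlation functions.  For an environment with discrete levels the two are related by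
`∑ c = ∑ (c x) / x`, where `x` runs over the frequencies and `c x` are the Fourier coefficients of
a combination `h` of real-time correlation functions.  As `1 / x` is `i ∫₀^∞ e^{-itx} dt` after
Abel regularisation, one expects `∑ c = i ∫₀^∞ h`.  The regularised identity passes to the limit
by dominated convergence.  Removing the regulator `η` costs at most the spectral weight in a
Lorentzian of width `η` around `x = 0`, and this weight is `O(η)` in the limit, because it is a
Laplace transform of the limiting autocorrelations, which are integrable.  This is
`tendsto_tsum_of_tendsto_character_sums`.

The same spectral sum may be represented on positive or on negative times, by reversing the sign of
all frequencies.  The two limits must agree (`lateSpectral_eq_neg`), and this is the KMS relation,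
first between half-line integrals and then between Fourier transforms (`fourierT_kms`); no weak
convergence of spectral measures is needed.

The second-order Dyson kernel is a second divided difference of the exponential, so that off the
diagonal it is a difference quotient of first divided differences
(`integral_exp_mul_boltzmannConv`).  Hence the second-order coefficient of the closed system is a
difference quotient of spectral sums (`trEnv_closedGibbs_two`).  On the side of the master equation
the KMS relation turns the matrix elements of `𝓛₂ ρ_S` into differences of the limits of these
sums (`lateLiouville2_thermal`): they vanish on the diagonal, whence a stationary correction exists,
and off the diagonal they match the limit of the closed system, which may be taken under the sum
over intermediate levels by `tendsto_tsum_spectralSum`.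

For finite-dimensional systems the remainder of the Dyson series is bounded by iterating Duhamel's
formula (`exists_norm_dysonRemainder_le`), and the quotient of Taylor polynomials is compared with
the quotient of power series (`isBigO_div_sub`).
-/

noncomputable section

namespace OpenSystem

/-! ### Laplace regularisation of almost periodic sums -/

/-- The Laplace transform of a character of the half line. -/
lemma integral_exp_neg_mul_character (η : ℝ) (hη : 0 < η) (x : ℝ) :
    ∫ t in Set.Ioi (0 : ℝ), (Real.exp (-(η * t)) : ℂ) * Complex.exp (-(Complex.I * t * x)) =
      ((η : ℂ) + Complex.I * x)⁻¹ := by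
  have h := integral_exp_mul_complex_Ioi (a := -((η : ℂ) + Complex.I * x)) (by simpa using hη) 0
  rw [div_eq_mul_inv, inv_neg] at h
  simp only [Complex.ofReal_zero, mul_zero, Complex.exp_zero, neg_mul_neg, one_mul] at h
  rw [← h]
  refine setIntegral_congr_fun measurableSet_Ioi fun t _ => ?_
  simp only [Complex.ofReal_exp]
  rw [← Complex.exp_add]
  congr 1
  push_cast
  ring

lemma norm_character (t x : ℝ) : ‖Complex.exp (-(Complex.I * t * x))‖ = 1 := by
  rw [Complex.norm_exp]
  simp

lemma integrableOn_exp_neg_mul (η : ℝ) (hη : 0 < η) :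
    IntegrableOn (fun t : ℝ => Real.exp (-(η * t))) (Set.Ioi 0) := by
  simpa [neg_mul] using integrableOn_exp_mul_Ioi (a := -η) (by linarith) 0

/-- The Laplace transform of an absolutely convergent almost periodic sum, term by term. -/
lemma integral_exp_neg_mul_tsum {K : Type*} [Countable K] (c : K → ℂ) (x : K → ℝ)
    (hc : Summable fun k => ‖c k‖) (η : ℝ) (hη : 0 < η) :
    ∫ t in Set.Ioi (0 : ℝ),
        (Real.exp (-(η * t)) : ℂ) * ∑' k, c k * Complex.exp (-(Complex.I * t * x k)) =
      ∑' k, c k * ((η : ℂ) + Complex.I * x k)⁻¹ := by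
  have hint : ∀ k, Integrable (fun t : ℝ => (Real.exp (-(η * t)) : ℂ) *
      (c k * Complex.exp (-(Complex.I * t * x k)))) (volume.restrict (Set.Ioi 0)) := by
    intro k
    refine Integrable.mono' ((integrableOn_exp_neg_mul η hη).mul_const ‖c k‖) ?_ ?_
    · exact Continuous.aestronglyMeasurable (by fun_prop)
    · refine Eventually.of_forall fun t => ?_
      rw [norm_mul, norm_mul, norm_character, mul_one, Complex.norm_real, Real.norm_eq_abs,
        abs_of_pos (Real.exp_pos _)]
  have key := integral_tsum_of_summable_integral_norm hint ?_
  · have h1 : ∀ k, ∫ t in Set.Ioi (0 : ℝ), (Real.exp (-(η * t)) : ℂ) *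
        (c k * Complex.exp (-(Complex.I * t * x k))) = c k * ((η : ℂ) + Complex.I * x k)⁻¹ := by
      intro k
      rw [← integral_exp_neg_mul_character η hη, ← integral_const_mul]
      congr 1; ext t; ring
    simp_rw [h1] at key
    rw [key]
    congr 1; ext t
    rw [tsum_mul_left]
  · have : ∀ k, ∫ t in Set.Ioi (0 : ℝ), ‖(Real.exp (-(η * t)) : ℂ) *
        (c k * Complex.exp (-(Complex.I * t * x k)))‖ =
        (∫ t in Set.Ioi (0 : ℝ), Real.exp (-(η * t))) * ‖c k‖ := by
      intro k
      rw [← integral_mul_const]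
      congr 1; ext t
      rw [norm_mul, norm_mul, norm_character, mul_one, Complex.norm_real, Real.norm_eq_abs,
        abs_of_pos (Real.exp_pos _)]
    simp_rw [this]
    exact hc.mul_left _

/-- Pointwise convergence of uniformly bounded almost periodic sums passes to their Laplace
transforms. -/
lemma tendsto_tsum_laplace {K : ℕ → Type*} [∀ N, Countable (K N)] (c : ∀ N, K N → ℂ)
    (x : ∀ N, K N → ℝ) (hc : ∀ N, Summable fun k => ‖c N k‖) (B : ℝ)
    (hB : ∀ N, ∑' k, ‖c N k‖ ≤ B) (Q : ℝ → ℂ)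
    (hQ : ∀ t : ℝ, Tendsto (fun N => ∑' k, c N k * Complex.exp (-(Complex.I * t * x N k))) atTop
      (𝓝 (Q t))) (η : ℝ) (hη : 0 < η) :
    Tendsto (fun N => ∑' k, c N k * ((η : ℂ) + Complex.I * x N k)⁻¹) atTop
      (𝓝 (∫ t in Set.Ioi (0 : ℝ), (Real.exp (-(η * t)) : ℂ) * Q t)) := by
  simp_rw [← fun N => integral_exp_neg_mul_tsum (c N) (x N) (hc N) η hη]
  refine tendsto_integral_of_dominated_convergence (fun t => Real.exp (-(η * t)) * B) ?_ ?_ ?_ ?_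
  · intro N
    refine Continuous.aestronglyMeasurable ?_
    refine Continuous.mul (by fun_prop) ?_
    refine continuous_tsum (u := fun k => ‖c N k‖) (fun k => by fun_prop) (hc N) ?_
    intro k t
    rw [norm_mul, norm_character, mul_one]
  · exact (integrableOn_exp_neg_mul η hη).mul_const B
  · intro N
    refine Eventually.of_forall fun t => ?_
    rw [norm_mul, Complex.norm_real, Real.norm_eq_abs, abs_of_pos (Real.exp_pos _)]
    refine mul_le_mul_of_nonneg_left ?_ (Real.exp_pos _).le
    refine le_trans (norm_tsum_le_tsum_norm ?_) (le_trans (le_of_eq ?_) (hB N))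
    · simpa [norm_character] using hc N
    · simp [norm_character]
  · exact Eventually.of_forall fun t => (hQ t).const_mul _

/-- Abel summation: the regularised integral tends to the integral. -/
lemma tendsto_integral_exp_neg_mul (h : ℝ → ℂ) (hh : IntegrableOn h (Set.Ioi 0)) :
    Tendsto (fun η : ℝ => ∫ t in Set.Ioi (0 : ℝ), (Real.exp (-(η * t)) : ℂ) * h t) (𝓝[>] 0)
      (𝓝 (∫ t in Set.Ioi (0 : ℝ), h t)) := by
  refine tendsto_integral_filter_of_dominated_convergence (fun t => ‖h t‖) ?_ ?_ hh.norm ?_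
  · refine Eventually.of_forall fun η => AEStronglyMeasurable.mul ?_ hh.aestronglyMeasurable
    exact Continuous.aestronglyMeasurable (by fun_prop)
  · filter_upwards [self_mem_nhdsWithin] with η hη
    filter_upwards [ae_restrict_mem measurableSet_Ioi] with t ht
    rw [norm_mul, Complex.norm_real, Real.norm_eq_abs, abs_of_pos (Real.exp_pos _)]
    refine mul_le_of_le_one_left (norm_nonneg _) (Real.exp_le_one_iff.2 ?_)
    have := mul_pos (Set.mem_Ioi.1 hη) (Set.mem_Ioi.1 ht)
    linarith
  · refine Eventually.of_forall fun t => ?_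
    have : Tendsto (fun η : ℝ => (Real.exp (-(η * t)) : ℂ) * h t) (𝓝 0)
        (𝓝 ((Real.exp (-(0 * t)) : ℂ) * h t)) :=
      Continuous.tendsto (f := fun η : ℝ => (Real.exp (-(η * t)) : ℂ) * h t) (by fun_prop) 0
    simpa using this.mono_left nhdsWithin_le_nhds

/-- Removing the regularisation costs `η / |η + ix|`, and by the inequality of the arithmetic and
geometric means this is controlled by `√η` and a Lorentzian of width `η`. -/
lemma norm_one_sub_regularised_le (η : ℝ) (hη : 0 < η) (x : ℝ) :
    ‖1 - Complex.I * (x * ((η : ℂ) + Complex.I * x)⁻¹)‖ ≤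
      √η / 2 * (1 + (((η : ℂ) + Complex.I * x)⁻¹).re) := by
  have hne : (η : ℂ) + Complex.I * x ≠ 0 := by
    intro h
    have := congrArg Complex.re h
    simp at this
    linarith
  have h1 : 1 - Complex.I * (x * ((η : ℂ) + Complex.I * x)⁻¹) =
      η * ((η : ℂ) + Complex.I * x)⁻¹ := by
    field_simp
    ring
  have hn : Complex.normSq ((η : ℂ) + Complex.I * x) = η ^ 2 + x ^ 2 := by
    simp [Complex.normSq_apply]; ring
  have hpos : 0 < η ^ 2 + x ^ 2 := by positivity
  set r := √(η ^ 2 + x ^ 2) with hr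
  have hrpos : 0 < r := Real.sqrt_pos.2 hpos
  have hr2 : r ^ 2 = η ^ 2 + x ^ 2 := Real.sq_sqrt hpos.le
  have hnorm : ‖(η : ℂ) + Complex.I * x‖ = r := by
    rw [Complex.norm_def, hn]
  have hre : (((η : ℂ) + Complex.I * x)⁻¹).re = η / r ^ 2 := by
    rw [Complex.inv_re, hn, hr2]
    simp
  rw [h1, norm_mul, norm_inv, hnorm, hre, Complex.norm_real, Real.norm_eq_abs, abs_of_pos hη]
  set q := √η with hq
  have hq2 : q ^ 2 = η := Real.sq_sqrt hη.le
  have hqpos : 0 < q := Real.sqrt_pos.2 hη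
  rw [← hq2]
  have : q / 2 * (1 + q ^ 2 / r ^ 2) - q ^ 2 * r⁻¹ = q / 2 * (1 - q / r) ^ 2 := by
    field_simp
    ring
  have h2 : 0 ≤ q / 2 * (1 - q / r) ^ 2 := by positivity
  linarith

/-- Spectral sums `∑ c` are recovered from the time-dependent sums `∑ c x e^{-itx}`, in a limit
in which only the latter are known to converge.  The hypothesis on `p` says that the spectral
weight, which dominates the coefficients, does not concentrate near `x = 0`. -/
theorem tendsto_tsum_of_tendsto_character_sums {K : ℕ → Type*} [∀ N, Countable (K N)]
    (c : ∀ N, K N → ℂ) (x p : ∀ N, K N → ℝ) (hp : ∀ N, Summable (p N))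
    (hc : ∀ N k, ‖c N k‖ ≤ p N k) (hcx : ∀ N k, ‖c N k * x N k‖ ≤ p N k)
    (P : ℝ → ℂ) (hP : IntegrableOn P (Set.Ioi 0))
    (hPlim : ∀ t : ℝ, Tendsto
      (fun N => ∑' k, (p N k : ℂ) * Complex.exp (-(Complex.I * t * x N k))) atTop (𝓝 (P t)))
    (h : ℝ → ℂ) (hh : IntegrableOn h (Set.Ioi 0))
    (hlim : ∀ t : ℝ, Tendsto
      (fun N => ∑' k, (c N k * x N k) * Complex.exp (-(Complex.I * t * x N k))) atTop (𝓝 (h t))) :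
    Tendsto (fun N => ∑' k, c N k) atTop (𝓝 (Complex.I * ∫ t in Set.Ioi (0 : ℝ), h t)) := by
  have hp0 : ∀ N k, 0 ≤ p N k := fun N k => (norm_nonneg _).trans (hc N k)
  have hpn : ∀ N k, ‖(p N k : ℂ)‖ = p N k := fun N k => by
    rw [Complex.norm_real, Real.norm_eq_abs, abs_of_nonneg (hp0 N k)]
  -- the total spectral weight is bounded, as its limit is `P 0`
  obtain ⟨B, hB⟩ : ∃ B, ∀ N, ∑' k, p N k ≤ B := by
    have h0 := (hPlim 0).norm.bddAbove_range
    obtain ⟨B, hB⟩ := h0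
    refine ⟨B, fun N => ?_⟩
    have := hB (Set.mem_range_self N)
    simp only [Complex.ofReal_zero, mul_zero, zero_mul, neg_zero, Complex.exp_zero, mul_one] at this
    rw [← Complex.ofReal_tsum, Complex.norm_real, Real.norm_eq_abs] at this
    exact (le_abs_self _).trans this
  have hB0 : 0 ≤ B := (tsum_nonneg (hp0 0)).trans (hB 0)
  have hcs : ∀ N, Summable fun k => ‖c N k‖ := fun N =>
    Summable.of_nonneg_of_le (fun _ => norm_nonneg _) (hc N) (hp N)
  have hcxs : ∀ N, Summable fun k => ‖c N k * x N k‖ := fun N =>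
    Summable.of_nonneg_of_le (fun _ => norm_nonneg _) (hcx N) (hp N)
  have hLP := tendsto_tsum_laplace (fun N k => (p N k : ℂ)) x
    (fun N => by simp only [hpn]; exact hp N) B
    (fun N => by simp only [hpn]; exact hB N) P hPlim
  have hLh := tendsto_tsum_laplace (fun N k => c N k * x N k) x hcxs B
    (fun N => ((hcxs N).tsum_le_tsum (hcx N) (hp N)).trans (hB N)) h hlim
  set D := ∫ t in Set.Ioi (0 : ℝ), ‖P t‖ with hD
  have hD0 : 0 ≤ D := integral_nonneg fun _ => norm_nonneg _
  have hLPbound : ∀ η : ℝ, 0 < η →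
      ‖∫ t in Set.Ioi (0 : ℝ), (Real.exp (-(η * t)) : ℂ) * P t‖ ≤ D := by
    intro η hη
    refine norm_integral_le_of_norm_le hP.norm ?_
    filter_upwards [ae_restrict_mem measurableSet_Ioi] with t ht
    rw [norm_mul, Complex.norm_real, Real.norm_eq_abs, abs_of_pos (Real.exp_pos _)]
    refine mul_le_of_le_one_left (norm_nonneg _) (Real.exp_le_one_iff.2 ?_)
    have := mul_pos hη (Set.mem_Ioi.1 ht)
    linarith
  have hinv : ∀ η : ℝ, 0 < η → ∀ y : ℝ, ‖((η : ℂ) + Complex.I * y)⁻¹‖ ≤ η⁻¹ := by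
    intro η hη y
    rw [norm_inv]
    refine inv_anti₀ hη ?_
    have := Complex.abs_re_le_norm ((η : ℂ) + Complex.I * y)
    simpa [abs_of_pos hη] using this
  -- the distance between the sum and its regularisation
  have hdiff : ∀ η : ℝ, 0 < η → ∀ N,
      ‖∑' k, c N k - Complex.I * ∑' k, (c N k * x N k) * ((η : ℂ) + Complex.I * x N k)⁻¹‖ ≤
        √η / 2 * (B + ‖∑' k, (p N k : ℂ) * ((η : ℂ) + Complex.I * x N k)⁻¹‖) := by
    intro η hη N
    have hs1 : Summable fun k => (c N k * x N k) * ((η : ℂ) + Complex.I * x N k)⁻¹ := by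
      refine Summable.of_norm_bounded ((hcxs N).mul_right η⁻¹) fun k => ?_
      rw [norm_mul]
      exact mul_le_mul_of_nonneg_left (hinv η hη _) (norm_nonneg _)
    have hs2 : Summable fun k => (p N k : ℂ) * ((η : ℂ) + Complex.I * x N k)⁻¹ := by
      refine Summable.of_norm_bounded ((hp N).mul_right η⁻¹) fun k => ?_
      rw [norm_mul, hpn]
      exact mul_le_mul_of_nonneg_left (hinv η hη _) (hp0 N k)
    have hs3 : Summable fun k => p N k * (((η : ℂ) + Complex.I * x N k)⁻¹).re := by
      simpa [Complex.re_ofReal_mul] using (Complex.hasSum_re hs2.hasSum).summable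
    have hs4 : Summable fun k =>
        √η / 2 * (p N k + p N k * (((η : ℂ) + Complex.I * x N k)⁻¹).re) :=
      ((hp N).add hs3).mul_left _
    rw [← tsum_mul_left, ← (hcs N).of_norm.tsum_sub (hs1.mul_left _)]
    refine (tsum_of_norm_bounded hs4.hasSum fun k => ?_).trans ?_
    · have : c N k - Complex.I * (c N k * x N k * ((η : ℂ) + Complex.I * x N k)⁻¹) =
          c N k * (1 - Complex.I * (x N k * ((η : ℂ) + Complex.I * x N k)⁻¹)) := by ring
      rw [this, norm_mul]
      refine (mul_le_mul (hc N k) (norm_one_sub_regularised_le η hη _) (norm_nonneg _)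
        (hp0 N k)).trans (le_of_eq ?_)
      ring
    · rw [tsum_mul_left, (hp N).tsum_add hs3]
      refine mul_le_mul_of_nonneg_left (add_le_add (hB N) ?_) (by positivity)
      have h5 : ∑' k, p N k * (((η : ℂ) + Complex.I * x N k)⁻¹).re =
          (∑' k, (p N k : ℂ) * ((η : ℂ) + Complex.I * x N k)⁻¹).re := by
        rw [Complex.re_tsum hs2]
        simp
      rw [h5]
      exact Complex.re_le_norm _
  -- the error that remains in the limit vanishes with the regularisation
  have herr : Tendsto (fun η : ℝ => √η / 2 * (B + (D + 1)) + (η +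
      ‖(∫ t in Set.Ioi (0 : ℝ), (Real.exp (-(η * t)) : ℂ) * h t) -
        ∫ t in Set.Ioi (0 : ℝ), h t‖)) (𝓝[>] 0) (𝓝 0) := by
    have h1 : Tendsto (fun η : ℝ => √η / 2 * (B + (D + 1))) (𝓝[>] 0) (𝓝 0) := by
      have : Tendsto (fun η : ℝ => √η / 2 * (B + (D + 1))) (𝓝 0) (𝓝 (√0 / 2 * (B + (D + 1)))) :=
        Continuous.tendsto (f := fun η : ℝ => √η / 2 * (B + (D + 1))) (by fun_prop) 0
      simpa using this.mono_left nhdsWithin_le_nhds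
    have h2 : Tendsto (fun η : ℝ => η) (𝓝[>] 0) (𝓝 0) := nhdsWithin_le_nhds
    have h3 := tendsto_iff_norm_sub_tendsto_zero.1 (tendsto_integral_exp_neg_mul h hh)
    simpa using h1.add (h2.add h3)
  rw [Metric.tendsto_nhds]
  intro e he
  obtain ⟨η, hηe, hη⟩ := ((herr.eventually (gt_mem_nhds he)).and self_mem_nhdsWithin).exists
  have hη : 0 < η := hη
  have e1 := (hLP η hη).norm.eventually (gt_mem_nhds
    (lt_of_le_of_lt (hLPbound η hη) (lt_add_one D)))
  have e2 := (Metric.tendsto_nhds.1 (hLh η hη)) η hη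
  filter_upwards [e1, e2] with N h1 h2
  rw [dist_eq_norm] at h2 ⊢
  refine lt_of_le_of_lt ?_ hηe
  set S := ∑' k, (c N k * x N k) * ((η : ℂ) + Complex.I * x N k)⁻¹
  set T := ∫ t in Set.Ioi (0 : ℝ), (Real.exp (-(η * t)) : ℂ) * h t
  set U := ∫ t in Set.Ioi (0 : ℝ), h t
  have : ∑' k, c N k - Complex.I * U = (∑' k, c N k - Complex.I * S) + (Complex.I * (S - T) +
      Complex.I * (T - U)) := by ring
  rw [this]
  refine (norm_add_le _ _).trans (add_le_add ((hdiff η hη N).trans ?_)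
    ((norm_add_le _ _).trans (add_le_add ?_ ?_)))
  · exact mul_le_mul_of_nonneg_left (add_le_add le_rfl h1.le) (by positivity)
  · rw [norm_mul, Complex.norm_I, one_mul]; exact h2.le
  · rw [norm_mul, Complex.norm_I, one_mul]

/-! ### Convolutions of Boltzmann factors -/

/-- The convolution `∫₀ᵗ e^{-(t-s)A} e^{-sB} ds` of two Boltzmann factors; up to sign the divided
difference of `e^{-t·}` at `A` and `B`. -/
def boltzmannConv (t A B : ℝ) : ℝ :=
  ∫ s in (0 : ℝ)..t, Real.exp (-((t - s) * A)) * Real.exp (-(s * B))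

lemma hasDerivAt_exp_neg_sub_mul (t A s : ℝ) :
    HasDerivAt (fun s : ℝ => Real.exp (-((t - s) * A))) (Real.exp (-((t - s) * A)) * A) s := by
  have h : HasDerivAt (fun s : ℝ => -((t - s) * A)) A s :=
    HasDerivAt.congr_deriv (((hasDerivAt_id s).const_sub t).mul_const A).neg (by simp)
  exact h.exp

lemma hasDerivAt_exp_neg_mul (A s : ℝ) :
    HasDerivAt (fun s : ℝ => Real.exp (-(s * A))) (Real.exp (-(s * A)) * (-A)) s := by
  have h : HasDerivAt (fun s : ℝ => -(s * A)) (-A) s :=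
    HasDerivAt.congr_deriv ((hasDerivAt_id s).mul_const A).neg (by simp)
  exact h.exp

lemma boltzmannConv_mul_sub (t A B : ℝ) :
    boltzmannConv t A B * (A - B) = Real.exp (-(t * B)) - Real.exp (-(t * A)) := by
  have hd : ∀ s ∈ Set.uIcc 0 t, HasDerivAt
      (fun s : ℝ => Real.exp (-((t - s) * A)) * Real.exp (-(s * B)))
      (Real.exp (-((t - s) * A)) * Real.exp (-(s * B)) * (A - B)) s := by
    intro s _
    exact HasDerivAt.congr_deriv
      ((hasDerivAt_exp_neg_sub_mul t A s).mul (hasDerivAt_exp_neg_mul B s)) (by ring)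
  have := intervalIntegral.integral_eq_sub_of_hasDerivAt hd
    (Continuous.intervalIntegrable (by fun_prop) _ _)
  rw [intervalIntegral.integral_mul_const] at this
  rw [boltzmannConv, this]
  simp

lemma boltzmannConv_comm (t A B : ℝ) : boltzmannConv t A B = boltzmannConv t B A := by
  have := intervalIntegral.integral_comp_sub_left (a := 0) (b := t)
    (fun s : ℝ => Real.exp (-((t - s) * A)) * Real.exp (-(s * B))) t
  simp only [sub_zero, sub_self, sub_sub_cancel] at this
  rw [boltzmannConv, ← this, boltzmannConv]
  congr 1; ext s; ring

lemma boltzmannConv_nonneg {t : ℝ} (ht : 0 ≤ t) (A B : ℝ) : 0 ≤ boltzmannConv t A B :=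
  intervalIntegral.integral_nonneg ht fun _ _ => by positivity

/-- The interpolated Boltzmann factor is at most the sum of those at the end points. -/
lemma exp_mul_exp_le_add {t s : ℝ} (hs : 0 ≤ s) (hst : s ≤ t) (A B : ℝ) :
    Real.exp (-((t - s) * A)) * Real.exp (-(s * B)) ≤
      Real.exp (-(t * A)) + Real.exp (-(t * B)) := by
  rw [← Real.exp_add]
  rcases le_total A B with h | h
  · have : -((t - s) * A) + -(s * B) ≤ -(t * A) := by nlinarith
    have := Real.exp_le_exp.2 this
    have := Real.exp_pos (-(t * B))
    linarith
  · have : -((t - s) * A) + -(s * B) ≤ -(t * B) := by nlinarith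
    have := Real.exp_le_exp.2 this
    have := Real.exp_pos (-(t * A))
    linarith

lemma boltzmannConv_le {t : ℝ} (ht : 0 ≤ t) (A B : ℝ) :
    boltzmannConv t A B ≤ t * (Real.exp (-(t * A)) + Real.exp (-(t * B))) := by
  have := intervalIntegral.integral_mono_on ht
    (Continuous.intervalIntegrable (μ := volume) (by fun_prop) _ _)
    (Continuous.intervalIntegrable (μ := volume) (by fun_prop) _ _)
    (fun s (hs : s ∈ Set.Icc 0 t) => exp_mul_exp_le_add hs.1 hs.2 A B)
  simpa [boltzmannConv, mul_add] using this

lemma boltzmannConv_eq_exp_mul (t A B : ℝ) :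
    boltzmannConv t A B = Real.exp (-(t * A)) * ∫ s in (0 : ℝ)..t, Real.exp (s * (A - B)) := by
  rw [boltzmannConv, ← intervalIntegral.integral_const_mul]
  congr 1; ext s
  rw [← Real.exp_add, ← Real.exp_add]
  congr 1; ring

lemma hasDerivAt_boltzmannConv (t A B : ℝ) :
    HasDerivAt (fun t => boltzmannConv t A B)
      (-A * boltzmannConv t A B + Real.exp (-(t * B))) t := by
  have hcont : Continuous fun s : ℝ => Real.exp (s * (A - B)) := by fun_prop
  have h2 : HasDerivAt (fun t : ℝ => ∫ s in (0 : ℝ)..t, Real.exp (s * (A - B)))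
      (Real.exp (t * (A - B))) t :=
    intervalIntegral.integral_hasDerivAt_right (hcont.intervalIntegrable _ _)
      (hcont.stronglyMeasurableAtFilter _ _) hcont.continuousAt
  simp_rw [boltzmannConv_eq_exp_mul]
  refine HasDerivAt.congr_deriv ((hasDerivAt_exp_neg_mul A t).mul h2) ?_
  rw [← Real.exp_add]
  have : -(t * A) + t * (A - B) = -(t * B) := by ring
  rw [this]
  ring

lemma continuous_boltzmannConv (A B : ℝ) : Continuous fun t => boltzmannConv t A B :=
  continuous_iff_continuousAt.2 fun t => (hasDerivAt_boltzmannConv t A B).continuousAt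

/-- The second-order Dyson kernel is a second divided difference of the exponential, here in
terms of first divided differences at the distinct outer points; the inner point may coincide with
either of them. -/
lemma integral_exp_mul_boltzmannConv (t A B D : ℝ) (h : A ≠ D) :
    ∫ s in (0 : ℝ)..t, Real.exp (-((t - s) * A)) * boltzmannConv s B D =
      (boltzmannConv t A B - boltzmannConv t D B) / (D - A) := by
  have hDA : D - A ≠ 0 := sub_ne_zero.2 h.symm
  have hd : ∀ s ∈ Set.uIcc 0 t, HasDerivAt
      (fun s : ℝ => Real.exp (-((t - s) * A)) *
        ((boltzmannConv s A B - boltzmannConv s D B) / (D - A)))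
      (Real.exp (-((t - s) * A)) * boltzmannConv s B D) s := by
    intro s _
    have h2 := ((hasDerivAt_boltzmannConv s A B).sub (hasDerivAt_boltzmannConv s D B)).div_const
      (D - A)
    refine HasDerivAt.congr_deriv ((hasDerivAt_exp_neg_sub_mul t A s).mul h2) ?_
    rw [boltzmannConv_comm s B D]
    field_simp
    ring
  have hc : Continuous fun s : ℝ => Real.exp (-((t - s) * A)) * boltzmannConv s B D :=
    Continuous.mul (by fun_prop) (continuous_boltzmannConv B D)
  rw [intervalIntegral.integral_eq_sub_of_hasDerivAt hd (hc.intervalIntegrable _ _)]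
  simp [boltzmannConv]

/-! ### Correlation functions of an environment with discrete levels -/

lemma tr_boltzmann {a : Type*} [DecidableEq a] (E : a → ℝ) (t : ℝ) :
    tr (boltzmann E t) = ((∑' i, Real.exp (-(t * E i)) : ℝ) : ℂ) := by
  rw [Complex.ofReal_tsum]
  simp [tr, boltzmann]

lemma mmul_diagonal_left {a : Type*} [DecidableEq a] (d : a → ℂ) (X : Matrix a a ℂ) (i j : a) :
    mmul (Matrix.diagonal d) X i j = d i * X i j := by
  rw [mmul, tsum_eq_single i]
  · simp
  · intro k hk
    simp [Matrix.diagonal_apply_ne' _ hk]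

lemma mmul_diagonal_right {a : Type*} [DecidableEq a] (d : a → ℂ) (X : Matrix a a ℂ) (i j : a) :
    mmul X (Matrix.diagonal d) i j = X i j * d j := by
  rw [mmul, tsum_eq_single j]
  · simp
  · intro k hk
    simp [Matrix.diagonal_apply_ne _ hk]

lemma mmul_boltzmann_left {a : Type*} [DecidableEq a] (E : a → ℝ) (t : ℝ) (X : Matrix a a ℂ)
    (i j : a) : mmul (boltzmann E t) X i j = (Real.exp (-(t * E i)) : ℂ) * X i j :=
  mmul_diagonal_left _ _ _ _

lemma mmul_boltzmann_right {a : Type*} [DecidableEq a] (E : a → ℝ) (t : ℝ) (X : Matrix a a ℂ)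
    (i j : a) : mmul X (boltzmann E t) i j = X i j * (Real.exp (-(t * E j)) : ℂ) :=
  mmul_diagonal_right _ _ _ _

lemma tsum_exp_pos {a : Type*} [Nonempty a] (β : ℝ) (E : a → ℝ)
    (h : Summable fun i => Real.exp (-(β * E i))) : 0 < ∑' i, Real.exp (-(β * E i)) :=
  h.tsum_pos (fun _ => (Real.exp_pos _).le) (Classical.arbitrary a) (Real.exp_pos _)

lemma tr_boltzmann_ne_zero {a : Type*} [DecidableEq a] [Nonempty a] {β : ℝ} {E : a → ℝ}
    (h : Summable fun i => Real.exp (-(β * E i))) : tr (boltzmann E β) ≠ 0 := by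
  rw [tr_boltzmann]
  exact_mod_cast (tsum_exp_pos β E h).ne'

lemma countable_of_summable_exp {a : Type*} (β : ℝ) (E : a → ℝ)
    (h : Summable fun i => Real.exp (-(β * E i))) : Countable a := by
  have := h.countable_support
  rw [Function.support_eq_univ fun i => (Real.exp_pos _).ne'] at this
  exact Set.countable_univ_iff.1 this

lemma norm_apply_swap {a : Type*} {X : Matrix a a ℂ} (hX : X.IsHermitian) (i j : a) :
    ‖X i j‖ = ‖X j i‖ := by
  rw [← hX.apply i j, norm_star]

lemma apply_mul_apply_swap {a : Type*} {X : Matrix a a ℂ} (hX : X.IsHermitian) (i j : a) :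
    X i j * X j i = ((‖X i j‖ ^ 2 : ℝ) : ℂ) := by
  rw [← hX.apply j i, Complex.star_def, Complex.mul_conj, Complex.normSq_eq_norm_sq]

lemma norm_mul_le_half_add_sq {a : Type*} (X : Matrix a a ℂ) {Y : Matrix a a ℂ}
    (hY : Y.IsHermitian) (i j : a) :
    ‖X i j * Y j i‖ ≤ (‖X i j‖ ^ 2 + ‖Y i j‖ ^ 2) / 2 := by
  rw [norm_mul, norm_apply_swap hY j i]
  nlinarith [sq_nonneg (‖X i j‖ - ‖Y i j‖)]

section Correlations

variable {κ : Type*} {β : ℝ} {ε : κ → ℝ} {x y : Matrix κ κ ℂ}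

lemma summable_exp_mul_norm_mul (hy : y.IsHermitian)
    (hxv : Summable fun p : κ × κ => Real.exp (-(β * ε p.1)) * ‖x p.1 p.2‖ ^ 2)
    (hyv : Summable fun p : κ × κ => Real.exp (-(β * ε p.1)) * ‖y p.1 p.2‖ ^ 2) :
    Summable fun p : κ × κ => Real.exp (-(β * ε p.1)) * ‖x p.1 p.2 * y p.2 p.1‖ := by
  refine Summable.of_nonneg_of_le (fun _ => by positivity) (fun p => ?_)
    ((hxv.add hyv).mul_left (1 / 2))
  refine (mul_le_mul_of_nonneg_left (norm_mul_le_half_add_sq x hy p.1 p.2)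
    (Real.exp_pos _).le).trans (le_of_eq ?_)
  ring

lemma summable_swap_of_isHermitian (hx : x.IsHermitian)
    (hxv : Summable fun p : κ × κ => Real.exp (-(β * ε p.1)) * ‖x p.1 p.2‖ ^ 2) :
    Summable fun p : κ × κ => Real.exp (-(β * ε p.2)) * ‖x p.1 p.2‖ ^ 2 := by
  refine ((Equiv.prodComm κ κ).summable_iff.2 hxv).congr fun p => ?_
  simp [norm_apply_swap hx p.2 p.1]

variable [DecidableEq κ] [Nonempty κ]

/-- The correlation function as an almost periodic sum over pairs of levels. -/
lemma hasSum_envCorr (hZ : Summable fun μ => Real.exp (-(β * ε μ))) (hy : y.IsHermitian)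
    (hxv : Summable fun p : κ × κ => Real.exp (-(β * ε p.1)) * ‖x p.1 p.2‖ ^ 2)
    (hyv : Summable fun p : κ × κ => Real.exp (-(β * ε p.1)) * ‖y p.1 p.2‖ ^ 2) (t : ℝ) :
    HasSum (fun p : κ × κ => (Real.exp (-(β * ε p.1)) : ℂ) * (x p.1 p.2 * y p.2 p.1) *
      Complex.exp (-(Complex.I * t * (ε p.1 - ε p.2 : ℝ))))
      (tr (boltzmann ε β) * envCorr β ε x y (-t) 0) := by
  have hZ0 : tr (boltzmann ε β) ≠ 0 := tr_boltzmann_ne_zero hZ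
  have hs : Summable (fun p : κ × κ => (Real.exp (-(β * ε p.1)) : ℂ) *
      (x p.1 p.2 * y p.2 p.1) * Complex.exp (-(Complex.I * t * (ε p.1 - ε p.2 : ℝ)))) := by
    refine Summable.of_norm_bounded (summable_exp_mul_norm_mul hy hxv hyv) fun p => ?_
    rw [norm_mul, norm_character, mul_one, norm_mul, Complex.norm_real, Real.norm_eq_abs,
      abs_of_pos (Real.exp_pos _)]
  convert hs.hasSum using 1
  rw [hs.tsum_prod, envCorr, thermalMean, mul_div_cancel₀ _ hZ0, tr]
  congr 1; ext μ
  rw [mmul_boltzmann_left, mmul, ← tsum_mul_left]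
  congr 1; ext ν
  have : Complex.exp (-(Complex.I * t * (ε μ - ε ν : ℝ))) =
      Complex.exp (Complex.I * ((-t : ℝ) : ℂ) * ε μ) *
        Complex.exp (-(Complex.I * ((-t : ℝ) : ℂ) * ε ν)) := by
    rw [← Complex.exp_add]
    congr 1
    push_cast; ring
  rw [this]
  simp only [heisenberg, Complex.ofReal_zero, mul_zero, zero_mul, neg_zero, Complex.exp_zero,
    one_mul, mul_one]
  ring

/-- The correlation function with the roles of the two couplings exchanged, over the same
frequencies: its weights are those of `hasSum_envCorr` up to the factor `e^{β(ε_μ - ε_ν)}`. -/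
lemma hasSum_envCorr_swap (hZ : Summable fun μ => Real.exp (-(β * ε μ))) (hx : x.IsHermitian)
    (hxv : Summable fun p : κ × κ => Real.exp (-(β * ε p.1)) * ‖x p.1 p.2‖ ^ 2)
    (hyv : Summable fun p : κ × κ => Real.exp (-(β * ε p.1)) * ‖y p.1 p.2‖ ^ 2) (t : ℝ) :
    HasSum (fun p : κ × κ => (Real.exp (-(β * ε p.2)) : ℂ) * (x p.1 p.2 * y p.2 p.1) *
      Complex.exp (-(Complex.I * t * (ε p.1 - ε p.2 : ℝ))))
      (tr (boltzmann ε β) * envCorr β ε y x t 0) := by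
  have h := hasSum_envCorr hZ hx hyv hxv (-t)
  rw [neg_neg, ← (Equiv.prodComm κ κ).hasSum_iff] at h
  convert h using 1
  ext p
  simp only [Function.comp, Equiv.prodComm_apply, Prod.fst_swap, Prod.snd_swap]
  have : -(Complex.I * ((-t : ℝ) : ℂ) * (ε p.2 - ε p.1 : ℝ)) =
      -(Complex.I * t * (ε p.1 - ε p.2 : ℝ)) := by push_cast; ring
  rw [this]
  ring

lemma envCorr_swap_neg (hZ : Summable fun μ => Real.exp (-(β * ε μ))) (hx : x.IsHermitian)
    (hy : y.IsHermitian)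
    (hxv : Summable fun p : κ × κ => Real.exp (-(β * ε p.1)) * ‖x p.1 p.2‖ ^ 2)
    (hyv : Summable fun p : κ × κ => Real.exp (-(β * ε p.1)) * ‖y p.1 p.2‖ ^ 2) (t : ℝ) :
    envCorr β ε y x (-t) 0 = (starRingEnd ℂ) (envCorr β ε x y t 0) := by
  have hZ0 : tr (boltzmann ε β) ≠ 0 := tr_boltzmann_ne_zero hZ
  have h1 := hasSum_envCorr hZ hx hyv hxv t
  have h2 := hasSum_envCorr hZ hy hxv hyv (-t)
  rw [neg_neg] at h2
  have h3 := Complex.hasSum_conj'.2 h2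
  have hZc : (starRingEnd ℂ) (tr (boltzmann ε β)) = tr (boltzmann ε β) := by
    rw [tr_boltzmann, Complex.conj_ofReal]
  rw [map_mul, hZc] at h3
  refine mul_left_cancel₀ hZ0 (h1.unique ?_)
  convert h3 using 1
  ext p
  simp only [map_mul, ← Complex.exp_conj, Complex.conj_ofReal, map_neg, Complex.conj_I]
  rw [← hx.apply p.2 p.1, ← hy.apply p.1 p.2]
  simp only [Complex.star_def]
  have : -(-Complex.I * ((-t : ℝ) : ℂ) * (ε p.1 - ε p.2 : ℝ)) =
      -(Complex.I * t * (ε p.1 - ε p.2 : ℝ)) := by push_cast; ring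
  rw [this]
  ring

end Correlations

/-! ### The reservoir limit -/

lemma lateCoeff_integrableOn {f : ℝ → ℂ} (hf : Integrable f) (w : ℝ) :
    IntegrableOn (fun τ : ℝ => Complex.exp (-(Complex.I * w * τ)) * f τ) (Set.Ioi 0) := by
  refine Integrable.mono' hf.norm.integrableOn
    (AEStronglyMeasurable.mul (Continuous.aestronglyMeasurable (by fun_prop))
      hf.aestronglyMeasurable.restrict) (Eventually.of_forall fun t => ?_)
  rw [norm_mul, norm_character, one_mul]

lemma norm_lateCoeff_le {f : ℝ → ℂ} (hf : Integrable f) (w : ℝ) :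
    ‖lateCoeff f w‖ ≤ ∫ t, ‖f t‖ := by
  refine (norm_integral_le_integral_norm _).trans ?_
  simp only [norm_mul, norm_character, one_mul]
  exact setIntegral_le_integral hf.norm (Eventually.of_forall fun _ => norm_nonneg _)

lemma conj_lateCoeff {f g : ℝ → ℂ} (hfg : ∀ t, g (-t) = (starRingEnd ℂ) (f t)) (w : ℝ) :
    (starRingEnd ℂ) (lateCoeff f w) =
      ∫ τ in Set.Ioi (0 : ℝ), Complex.exp (Complex.I * w * τ) * g (-τ) := by
  rw [lateCoeff, ← integral_conj]
  congr 1; ext τ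
  simp [map_mul, ← Complex.exp_conj, hfg]

/-- Two half-line transforms make up a Fourier transform. -/
lemma fourierT_eq_lateCoeff_add_conj {f g : ℝ → ℂ} (hf : Integrable f)
    (hfg : ∀ t, f (-t) = (starRingEnd ℂ) (g t)) (w : ℝ) :
    fourierT f w = lateCoeff f w + (starRingEnd ℂ) (lateCoeff g w) := by
  have hint : Integrable fun t : ℝ => Complex.exp (-(Complex.I * w * t)) * f t := by
    refine Integrable.mono' hf.norm
      (AEStronglyMeasurable.mul (Continuous.aestronglyMeasurable (by fun_prop))
        hf.aestronglyMeasurable) (Eventually.of_forall fun t => ?_)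
    rw [norm_mul, norm_character, one_mul]
  have h := integral_comp_neg_Ioi 0 (fun t : ℝ => Complex.exp (-(Complex.I * w * t)) * f t)
  rw [conj_lateCoeff hfg, fourierT, ← integral_add_compl measurableSet_Ioi hint, Set.compl_Ioi,
    lateCoeff]
  rw [neg_zero] at h
  rw [← h]
  congr 2; ext t
  congr 2
  push_cast; ring

section Limit

variable {J : Type*} {κ : ℕ → Type*} [∀ N, DecidableEq (κ N)] [∀ N, Nonempty (κ N)]
  {β : ℝ} {ε : ∀ N, κ N → ℝ} {l : ∀ N, J → Matrix (κ N) (κ N) ℂ} {α : J → J → ℝ → ℂ}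

lemma limitCorr_neg (hZE : ∀ N, Summable fun μ => Real.exp (-(β * ε N μ)))
    (hl : ∀ N n, (l N n).IsHermitian)
    (hlvar : ∀ N n, Summable fun p : κ N × κ N =>
      Real.exp (-(β * ε N p.1)) * ‖l N n p.1 p.2‖ ^ 2)
    (hαlim : ∀ n m t s, Tendsto
      (fun N => envCorr β (ε N) (l N n) (l N m) t s) atTop (𝓝 (α n m (t - s))))
    (n m : J) (t : ℝ) : α m n (-t) = (starRingEnd ℂ) (α n m t) := by
  have h1 := hαlim m n (-t) 0
  have h2 := (Complex.continuous_conj.tendsto _).comp (hαlim n m t 0)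
  rw [sub_zero] at h1 h2
  refine tendsto_nhds_unique h1 (h2.congr fun N => ?_)
  exact (envCorr_swap_neg (hZE N) (hl N n) (hl N m) (hlvar N n) (hlvar N m) t).symm

/-- The spectral sum of two couplings.  With `C(τ)` the imaginary-time correlation function
`∑ e^{-βε_μ} e^{τ(ε_μ - ε_ν)} x_μν y_νμ / Z` of the environment, it is
`∫₀^β e^{-(β - τ)E₁} e^{-τE₂} C(τ) dτ`, written with the integral inside the sum; `E₁` and `E₂`
are energies of the system. -/
def spectralSum {κ : Type*} [DecidableEq κ] (β : ℝ) (ε : κ → ℝ) (x y : Matrix κ κ ℂ)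
    (E₁ E₂ : ℝ) : ℂ :=
  (∑' p : κ × κ, x p.1 p.2 * y p.2 p.1 * (boltzmannConv β (E₁ + ε p.1) (E₂ + ε p.2) : ℂ)) /
    tr (boltzmann ε β)

/-- The spectral weight which dominates the coefficients of `spectralSum`, symmetrised so that it
is made up of autocorrelations at positive and negative times; not normalised. -/
def spectralWeight {κ : Type*} (β : ℝ) (ε : κ → ℝ) (x y : Matrix κ κ ℂ) (p : κ × κ) : ℝ :=
  (Real.exp (-(β * ε p.1)) + Real.exp (-(β * ε p.2))) *
    (‖x p.1 p.2‖ ^ 2 + ‖y p.1 p.2‖ ^ 2)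

lemma spectralWeight_nonneg {κ : Type*} (β : ℝ) (ε : κ → ℝ) (x y : Matrix κ κ ℂ) (p : κ × κ) :
    0 ≤ spectralWeight β ε x y p := by
  unfold spectralWeight; positivity

lemma summable_spectralWeight {κ : Type*} {β : ℝ} {ε : κ → ℝ} {x y : Matrix κ κ ℂ}
    (hx : x.IsHermitian) (hy : y.IsHermitian)
    (hxv : Summable fun p : κ × κ => Real.exp (-(β * ε p.1)) * ‖x p.1 p.2‖ ^ 2)
    (hyv : Summable fun p : κ × κ => Real.exp (-(β * ε p.1)) * ‖y p.1 p.2‖ ^ 2) :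
    Summable (spectralWeight β ε x y) := by
  refine ((hxv.add (summable_swap_of_isHermitian hx hxv)).add
    (hyv.add (summable_swap_of_isHermitian hy hyv))).congr fun p => ?_
  rw [spectralWeight]; ring

/-- The characteristic function of the spectral weight is a sum of autocorrelation functions, and
so converges to an integrable function in the reservoir limit. -/
lemma hasSum_spectralWeight {κ : Type*} [DecidableEq κ] [Nonempty κ] {β : ℝ} {ε : κ → ℝ}
    {x y : Matrix κ κ ℂ} (hZ : Summable fun μ => Real.exp (-(β * ε μ)))
    (hx : x.IsHermitian) (hy : y.IsHermitian)
    (hxv : Summable fun p : κ × κ => Real.exp (-(β * ε p.1)) * ‖x p.1 p.2‖ ^ 2)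
    (hyv : Summable fun p : κ × κ => Real.exp (-(β * ε p.1)) * ‖y p.1 p.2‖ ^ 2) (t : ℝ) :
    HasSum (fun p : κ × κ => (spectralWeight β ε x y p : ℂ) *
      Complex.exp (-(Complex.I * t * (ε p.1 - ε p.2 : ℝ))))
      (tr (boltzmann ε β) * ((envCorr β ε x x (-t) 0 + envCorr β ε x x t 0) +
        (envCorr β ε y y (-t) 0 + envCorr β ε y y t 0))) := by
  have h := ((hasSum_envCorr hZ hx hxv hxv t).add (hasSum_envCorr_swap hZ hx hxv hxv t)).add
    ((hasSum_envCorr hZ hy hyv hyv t).add (hasSum_envCorr_swap hZ hy hyv hyv t))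
  rw [← mul_add, ← mul_add, ← mul_add] at h
  convert h using 1
  ext p
  rw [apply_mul_apply_swap hx, apply_mul_apply_swap hy, spectralWeight]
  push_cast; ring

/-- The ratio of the coefficients of `spectralSum` to the spectral weight is at most this constant,
see `norm_mul_mul_boltzmannConv_le`; the summand `1` in the prefactor serves the coefficients
multiplied by their frequencies. -/
def shiftBound (β E₁ E₂ : ℝ) : ℝ := (β + 1) * (Real.exp (-(β * E₁)) + Real.exp (-(β * E₂)))

lemma shiftBound_nonneg {β : ℝ} (hβ : 0 < β) (E₁ E₂ : ℝ) : 0 ≤ shiftBound β E₁ E₂ := by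
  unfold shiftBound; positivity

lemma exp_add_exp_le (β E₁ E₂ a b : ℝ) :
    Real.exp (-(β * (E₁ + a))) + Real.exp (-(β * (E₂ + b))) ≤
      (Real.exp (-(β * E₁)) + Real.exp (-(β * E₂))) *
        (Real.exp (-(β * a)) + Real.exp (-(β * b))) := by
  have h1 : Real.exp (-(β * (E₁ + a))) = Real.exp (-(β * E₁)) * Real.exp (-(β * a)) := by
    rw [← Real.exp_add]; congr 1; ring
  have h2 : Real.exp (-(β * (E₂ + b))) = Real.exp (-(β * E₂)) * Real.exp (-(β * b)) := by
    rw [← Real.exp_add]; congr 1; ring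
  rw [h1, h2]
  have h3 : 0 ≤ Real.exp (-(β * E₁)) * Real.exp (-(β * b)) := by positivity
  have h4 : 0 ≤ Real.exp (-(β * E₂)) * Real.exp (-(β * a)) := by positivity
  linarith

lemma norm_mul_mul_le_spectralWeight {κ : Type*} {β : ℝ} (hβ : 0 < β) (ε : κ → ℝ)
    (x : Matrix κ κ ℂ) {y : Matrix κ κ ℂ} (hy : y.IsHermitian) (E₁ E₂ : ℝ) (p : κ × κ) (r : ℝ)
    (hr : |r| ≤ (β + 1) *
      (Real.exp (-(β * (E₁ + ε p.1))) + Real.exp (-(β * (E₂ + ε p.2))))) :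
    ‖x p.1 p.2 * y p.2 p.1 * (r : ℂ)‖ ≤ shiftBound β E₁ E₂ * spectralWeight β ε x y p := by
  rw [norm_mul, Complex.norm_real, Real.norm_eq_abs]
  have h1 := norm_mul_le_half_add_sq x hy p.1 p.2
  have h2 : |r| ≤ shiftBound β E₁ E₂ *
      (Real.exp (-(β * ε p.1)) + Real.exp (-(β * ε p.2))) := by
    refine hr.trans ?_
    rw [shiftBound, mul_assoc]
    exact mul_le_mul_of_nonneg_left (exp_add_exp_le _ _ _ _ _) (by positivity)
  have h3 : ‖x p.1 p.2 * y p.2 p.1‖ ≤ ‖x p.1 p.2‖ ^ 2 + ‖y p.1 p.2‖ ^ 2 :=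
    h1.trans (half_le_self (by positivity))
  refine (mul_le_mul h3 h2 (abs_nonneg _) (by positivity)).trans (le_of_eq ?_)
  rw [spectralWeight]; ring

lemma norm_mul_mul_boltzmannConv_le {κ : Type*} {β : ℝ} (hβ : 0 < β) (ε : κ → ℝ)
    (x : Matrix κ κ ℂ) {y : Matrix κ κ ℂ} (hy : y.IsHermitian) (E₁ E₂ : ℝ) (p : κ × κ) :
    ‖x p.1 p.2 * y p.2 p.1 * (boltzmannConv β (E₁ + ε p.1) (E₂ + ε p.2) : ℂ)‖ ≤
      shiftBound β E₁ E₂ * spectralWeight β ε x y p := by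
  refine norm_mul_mul_le_spectralWeight hβ ε x hy E₁ E₂ p _ ?_
  rw [abs_of_nonneg (boltzmannConv_nonneg hβ.le _ _)]
  refine (boltzmannConv_le hβ.le _ _).trans ?_
  exact mul_le_mul_of_nonneg_right (by linarith) (by positivity)

/-- The reservoir limit of `∑ c x e^{-itx}`, where `c` are the coefficients of `spectralSum`
and `x = (E₁ + ε_μ) - (E₂ + ε_ν)` their frequencies. -/
def spectralKernel (β : ℝ) (α : J → J → ℝ → ℂ) (n m : J) (E₁ E₂ t : ℝ) : ℂ :=
  Complex.exp (-(Complex.I * t * (E₁ - E₂ : ℝ))) *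
    ((Real.exp (-(β * E₂)) : ℂ) * α m n t - (Real.exp (-(β * E₁)) : ℂ) * α n m (-t))

lemma integrable_spectralKernel (hαdecay : ∀ n m, Integrable (α n m)) (n m : J) (E₁ E₂ : ℝ) :
    Integrable (spectralKernel β α n m E₁ E₂) := by
  have h : Integrable fun t => (Real.exp (-(β * E₂)) : ℂ) * α m n t -
      (Real.exp (-(β * E₁)) : ℂ) * α n m (-t) :=
    ((hαdecay m n).const_mul _).sub ((hαdecay n m).comp_neg.const_mul _)
  refine Integrable.mono' h.norm
    (AEStronglyMeasurable.mul (Continuous.aestronglyMeasurable (by fun_prop))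
      h.aestronglyMeasurable) (Eventually.of_forall fun t => ?_)
  rw [spectralKernel, norm_mul, norm_character, one_mul]

/-- The reservoir limit of `σ` times the spectral sum, for a sign `σ = ±1`.  The sign stands for
the half line of times on which the sum is represented; the comparison of the two half lines is
the KMS condition. -/
lemma tendsto_sign_mul_spectralSum (hβ : 0 < β)
    (hZE : ∀ N, Summable fun μ => Real.exp (-(β * ε N μ)))
    (hl : ∀ N n, (l N n).IsHermitian)
    (hlvar : ∀ N n, Summable fun p : κ N × κ N =>
      Real.exp (-(β * ε N p.1)) * ‖l N n p.1 p.2‖ ^ 2)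
    (hαlim : ∀ n m t s, Tendsto
      (fun N => envCorr β (ε N) (l N n) (l N m) t s) atTop (𝓝 (α n m (t - s))))
    (hαdecay : ∀ n m, Integrable (α n m)) (n m : J) (E₁ E₂ σ : ℝ) (hσ : σ * σ = 1) :
    Tendsto (fun N => (σ : ℂ) * spectralSum β (ε N) (l N n) (l N m) E₁ E₂) atTop
      (𝓝 (Complex.I * ∫ t in Set.Ioi (0 : ℝ), spectralKernel β α n m E₁ E₂ (σ * t))) := by
  have hσ0 : σ ≠ 0 := by rintro rfl; simp at hσ
  have hσabs : |σ| = 1 := by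
    have := abs_mul_abs_self σ
    rw [hσ] at this
    nlinarith [abs_nonneg σ]
  have hcount : ∀ N, Countable (κ N) := fun N => countable_of_summable_exp β (ε N) (hZE N)
  set z : ℕ → ℝ := fun N => ∑' μ, Real.exp (-(β * ε N μ)) with hz
  have hzpos : ∀ N, 0 < z N := fun N => tsum_exp_pos β (ε N) (hZE N)
  have hztr : ∀ N, tr (boltzmann (ε N) β) = (z N : ℂ) := fun N => tr_boltzmann _ _
  have hzne : ∀ N, (z N : ℂ) ≠ 0 := fun N => by exact_mod_cast (hzpos N).ne'
  set C := shiftBound β E₁ E₂ with hC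
  have hC0 : 0 ≤ C := shiftBound_nonneg hβ E₁ E₂
  -- the character of the shifted and signed frequency
  have hchar : ∀ (N : ℕ) (t : ℝ) (p : κ N × κ N),
      Complex.exp (-(Complex.I * t *
        ((σ * ((E₁ + ε N p.1) - (E₂ + ε N p.2)) : ℝ) : ℂ))) =
      Complex.exp (-(Complex.I * ((σ * t : ℝ) : ℂ) * (E₁ - E₂ : ℝ))) *
        Complex.exp (-(Complex.I * ((σ * t : ℝ) : ℂ) * (ε N p.1 - ε N p.2 : ℝ))) := by
    intro N t p
    rw [← Complex.exp_add]
    congr 1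
    push_cast; ring
  have hlim0 : ∀ n m t, Tendsto (fun N => envCorr β (ε N) (l N n) (l N m) t 0) atTop
      (𝓝 (α n m t)) := fun n m t => by simpa using hαlim n m t 0
  have key := tendsto_tsum_of_tendsto_character_sums
    (c := fun N (p : κ N × κ N) => (σ : ℂ) * (l N n p.1 p.2 * l N m p.2 p.1 *
      (boltzmannConv β (E₁ + ε N p.1) (E₂ + ε N p.2) : ℂ)) / (z N : ℂ))
    (x := fun N p => σ * ((E₁ + ε N p.1) - (E₂ + ε N p.2)))
    (p := fun N p => C * spectralWeight β (ε N) (l N n) (l N m) p / z N)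
    (fun N => ((summable_spectralWeight (hl N n) (hl N m) (hlvar N n) (hlvar N m)).mul_left
      C).div_const _)
    ?_ ?_
    (P := fun t => C * (Complex.exp (-(Complex.I * ((σ * t : ℝ) : ℂ) * (E₁ - E₂ : ℝ))) *
      ((α n n (-(σ * t)) + α n n (σ * t)) + (α m m (-(σ * t)) + α m m (σ * t))))) ?_ ?_
    (h := fun t => spectralKernel β α n m E₁ E₂ (σ * t))
    ((integrable_spectralKernel hαdecay n m E₁ E₂).comp_mul_left' hσ0).integrableOn ?_
  · refine key.congr fun N => ?_
    rw [spectralSum, hztr, tsum_div_const, tsum_mul_left, mul_div_assoc]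
  · intro N p
    rw [norm_div, norm_mul, Complex.norm_real, Complex.norm_real, Real.norm_eq_abs,
      Real.norm_eq_abs, abs_of_pos (hzpos N), hσabs, one_mul]
    exact div_le_div_of_nonneg_right
      (norm_mul_mul_boltzmannConv_le hβ (ε N) (l N n) (hl N m) E₁ E₂ p) (hzpos N).le
  · intro N p
    have h1 : (σ : ℂ) * (l N n p.1 p.2 * l N m p.2 p.1 *
        (boltzmannConv β (E₁ + ε N p.1) (E₂ + ε N p.2) : ℂ)) / (z N : ℂ) *
        ((σ * ((E₁ + ε N p.1) - (E₂ + ε N p.2)) : ℝ) : ℂ) =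
        l N n p.1 p.2 * l N m p.2 p.1 * ((Real.exp (-(β * (E₂ + ε N p.2))) -
          Real.exp (-(β * (E₁ + ε N p.1))) : ℝ) : ℂ) / (z N : ℂ) := by
      rw [← boltzmannConv_mul_sub]
      have : (σ : ℂ) * σ = 1 := by exact_mod_cast hσ
      push_cast
      linear_combination (l N n p.1 p.2 * l N m p.2 p.1 *
        (boltzmannConv β (E₁ + ε N p.1) (E₂ + ε N p.2) : ℂ) / (z N : ℂ) *
        (((E₁ + ε N p.1) : ℂ) - (E₂ + ε N p.2))) * this
    rw [h1, norm_div, Complex.norm_real, Real.norm_eq_abs, abs_of_pos (hzpos N)]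
    refine div_le_div_of_nonneg_right
      (norm_mul_mul_le_spectralWeight hβ (ε N) (l N n) (hl N m) E₁ E₂ p _ ?_) (hzpos N).le
    have e1 := Real.exp_pos (-(β * (E₁ + ε N p.1)))
    have e2 := Real.exp_pos (-(β * (E₂ + ε N p.2)))
    rw [abs_le]
    constructor <;> nlinarith
  · refine Integrable.integrableOn (Integrable.const_mul ?_ _)
    have hi : ∀ n, Integrable fun t => α n n (-(σ * t)) + α n n (σ * t) := fun n =>
      ((hαdecay n n).comp_neg.comp_mul_left' hσ0).add ((hαdecay n n).comp_mul_left' hσ0)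
    have h := (hi n).add (hi m)
    refine Integrable.mono' h.norm
      (AEStronglyMeasurable.mul (Continuous.aestronglyMeasurable (by fun_prop))
        h.aestronglyMeasurable) (Eventually.of_forall fun t => ?_)
    rw [norm_mul, norm_character, one_mul]
    rfl
  · intro t
    refine Tendsto.congr (fun N => ?_) (((((hlim0 n n (-(σ * t))).add (hlim0 n n (σ * t))).add
      ((hlim0 m m (-(σ * t))).add (hlim0 m m (σ * t)))).const_mul
      (Complex.exp (-(Complex.I * ((σ * t : ℝ) : ℂ) * (E₁ - E₂ : ℝ))))).const_mul (C : ℂ))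
    have h := (hasSum_spectralWeight (hZE N) (hl N n) (hl N m) (hlvar N n) (hlvar N m)
      (σ * t)).mul_left ((C : ℂ) / z N *
        Complex.exp (-(Complex.I * ((σ * t : ℝ) : ℂ) * (E₁ - E₂ : ℝ))))
    rw [hztr] at h
    have h2 : ∀ p : κ N × κ N,
        (((C * spectralWeight β (ε N) (l N n) (l N m) p / z N : ℝ)) : ℂ) *
          Complex.exp (-(Complex.I * t *
            ((σ * ((E₁ + ε N p.1) - (E₂ + ε N p.2)) : ℝ) : ℂ))) =
        (C : ℂ) / z N * Complex.exp (-(Complex.I * ((σ * t : ℝ) : ℂ) * (E₁ - E₂ : ℝ))) *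
          ((spectralWeight β (ε N) (l N n) (l N m) p : ℂ) *
            Complex.exp (-(Complex.I * ((σ * t : ℝ) : ℂ) * (ε N p.1 - ε N p.2 : ℝ)))) := by
      intro p
      rw [hchar]
      push_cast; ring
    simp_rw [h2, h.tsum_eq]
    field_simp [hzne N]
  · intro t
    refine Tendsto.congr (fun N => ?_) ((((hlim0 m n (σ * t)).const_mul
      (Real.exp (-(β * E₂)) : ℂ)).sub ((hlim0 n m (-(σ * t))).const_mul
      (Real.exp (-(β * E₁)) : ℂ))).const_mul
      (Complex.exp (-(Complex.I * ((σ * t : ℝ) : ℂ) * (E₁ - E₂ : ℝ)))))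
    have h := (((hasSum_envCorr_swap (hZE N) (hl N n) (hlvar N n) (hlvar N m) (σ * t)).mul_left
      (Real.exp (-(β * E₂)) : ℂ)).sub ((hasSum_envCorr (hZE N) (hl N m) (hlvar N n) (hlvar N m)
      (σ * t)).mul_left (Real.exp (-(β * E₁)) : ℂ))).mul_left ((z N : ℂ)⁻¹ *
        Complex.exp (-(Complex.I * ((σ * t : ℝ) : ℂ) * (E₁ - E₂ : ℝ))))
    rw [hztr] at h
    have h2 : ∀ p : κ N × κ N, ((σ : ℂ) * (l N n p.1 p.2 * l N m p.2 p.1 *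
        (boltzmannConv β (E₁ + ε N p.1) (E₂ + ε N p.2) : ℂ)) / (z N : ℂ) *
        ((σ * ((E₁ + ε N p.1) - (E₂ + ε N p.2)) : ℝ) : ℂ)) *
        Complex.exp (-(Complex.I * t * ((σ * ((E₁ + ε N p.1) - (E₂ + ε N p.2)) : ℝ) : ℂ))) =
        (z N : ℂ)⁻¹ * Complex.exp (-(Complex.I * ((σ * t : ℝ) : ℂ) * (E₁ - E₂ : ℝ))) *
        ((Real.exp (-(β * E₂)) : ℂ) * ((Real.exp (-(β * ε N p.2)) : ℂ) *
          (l N n p.1 p.2 * l N m p.2 p.1) *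
          Complex.exp (-(Complex.I * ((σ * t : ℝ) : ℂ) * (ε N p.1 - ε N p.2 : ℝ)))) -
        (Real.exp (-(β * E₁)) : ℂ) * ((Real.exp (-(β * ε N p.1)) : ℂ) *
          (l N n p.1 p.2 * l N m p.2 p.1) *
          Complex.exp (-(Complex.I * ((σ * t : ℝ) : ℂ) * (ε N p.1 - ε N p.2 : ℝ))))) := by
      intro p
      rw [hchar]
      have e1 : (boltzmannConv β (E₁ + ε N p.1) (E₂ + ε N p.2) : ℂ) *
          (((E₁ + ε N p.1) : ℂ) - (E₂ + ε N p.2)) =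
          (Real.exp (-(β * E₂)) : ℂ) * (Real.exp (-(β * ε N p.2)) : ℂ) -
          (Real.exp (-(β * E₁)) : ℂ) * (Real.exp (-(β * ε N p.1)) : ℂ) := by
        have := boltzmannConv_mul_sub β (E₁ + ε N p.1) (E₂ + ε N p.2)
        rw [mul_add, mul_add, neg_add, neg_add, Real.exp_add, Real.exp_add] at this
        exact_mod_cast this
      have e2 : (σ : ℂ) * σ = 1 := by exact_mod_cast hσ
      generalize Complex.exp (-(Complex.I * ((σ * t : ℝ) : ℂ) * (E₁ - E₂ : ℝ))) = X
      generalize Complex.exp (-(Complex.I * ((σ * t : ℝ) : ℂ) * (ε N p.1 - ε N p.2 : ℝ))) = Y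
      rw [Complex.ofReal_mul, Complex.ofReal_sub, Complex.ofReal_add, Complex.ofReal_add]
      generalize (Real.exp (-(β * E₂)) : ℂ) = u1 at *
      generalize (Real.exp (-(β * E₁)) : ℂ) = u2 at *
      generalize (Real.exp (-(β * ε N p.1)) : ℂ) = u3 at *
      generalize (Real.exp (-(β * ε N p.2)) : ℂ) = u4 at *
      generalize (boltzmannConv β (E₁ + ε N p.1) (E₂ + ε N p.2) : ℂ) = u5 at *
      linear_combination (l N n p.1 p.2 * l N m p.2 p.1 / (z N : ℂ) * X * Y) * e1 +
        (l N n p.1 p.2 * l N m p.2 p.1 * u5 / (z N : ℂ) *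
          (((E₁ + ε N p.1) : ℂ) - (E₂ + ε N p.2)) * X * Y) * e2
    simp_rw [h2, h.tsum_eq]
    field_simp [hzne N]

/-- The reservoir limit of the spectral sum, in terms of the late-time coefficients. -/
def lateSpectral (β : ℝ) (α : J → J → ℝ → ℂ) (n m : J) (E₁ E₂ : ℝ) : ℂ :=
  Complex.I * ((Real.exp (-(β * E₂)) : ℂ) * lateCoeff (α m n) (E₁ - E₂) -
    (Real.exp (-(β * E₁)) : ℂ) * (starRingEnd ℂ) (lateCoeff (α m n) (E₂ - E₁)))

lemma integral_spectralKernel (hαdecay : ∀ n m, Integrable (α n m))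
    (hαconj : ∀ n m t, α m n (-t) = (starRingEnd ℂ) (α n m t)) (n m : J) (E₁ E₂ : ℝ) :
    ∫ t in Set.Ioi (0 : ℝ), spectralKernel β α n m E₁ E₂ t =
      (Real.exp (-(β * E₂)) : ℂ) * lateCoeff (α m n) (E₁ - E₂) -
        (Real.exp (-(β * E₁)) : ℂ) * (starRingEnd ℂ) (lateCoeff (α m n) (E₂ - E₁)) := by
  rw [conj_lateCoeff (hαconj m n), lateCoeff, ← integral_const_mul, ← integral_const_mul,
    ← integral_sub]
  · congr 1; ext t
    rw [spectralKernel]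
    have e1 : -(Complex.I * t * ((E₁ - E₂ : ℝ) : ℂ)) =
        -(Complex.I * ((E₁ - E₂ : ℝ) : ℂ) * t) := by ring
    have e2 : Complex.I * ((E₂ - E₁ : ℝ) : ℂ) * t =
        -(Complex.I * ((E₁ - E₂ : ℝ) : ℂ) * t) := by push_cast; ring
    rw [e1, e2]; ring
  · exact (lateCoeff_integrableOn (hαdecay m n) _).const_mul _
  · refine Integrable.const_mul ?_ _
    refine (lateCoeff_integrableOn (hαdecay n m).comp_neg (-(E₂ - E₁))).congr
      (Eventually.of_forall fun t => ?_)
    dsimp only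
    congr 2
    push_cast; ring

lemma integral_spectralKernel_neg (hαdecay : ∀ n m, Integrable (α n m))
    (hαconj : ∀ n m t, α m n (-t) = (starRingEnd ℂ) (α n m t)) (n m : J) (E₁ E₂ : ℝ) :
    ∫ t in Set.Ioi (0 : ℝ), spectralKernel β α n m E₁ E₂ (-t) =
      (Real.exp (-(β * E₂)) : ℂ) * (starRingEnd ℂ) (lateCoeff (α n m) (E₁ - E₂)) -
        (Real.exp (-(β * E₁)) : ℂ) * lateCoeff (α n m) (E₂ - E₁) := by
  rw [conj_lateCoeff (hαconj n m), lateCoeff, ← integral_const_mul, ← integral_const_mul,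
    ← integral_sub]
  · congr 1; ext t
    rw [spectralKernel, neg_neg]
    have e1 : -(Complex.I * ((-t : ℝ) : ℂ) * ((E₁ - E₂ : ℝ) : ℂ)) =
        Complex.I * ((E₁ - E₂ : ℝ) : ℂ) * t := by push_cast; ring
    have e2 : -(Complex.I * ((E₂ - E₁ : ℝ) : ℂ) * t) =
        Complex.I * ((E₁ - E₂ : ℝ) : ℂ) * t := by push_cast; ring
    rw [e1, e2]; ring
  · refine Integrable.const_mul ?_ _
    refine (lateCoeff_integrableOn (hαdecay m n).comp_neg (-(E₁ - E₂))).congr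
      (Eventually.of_forall fun t => ?_)
    dsimp only
    congr 2
    push_cast; ring
  · exact (lateCoeff_integrableOn (hαdecay n m) _).const_mul _

theorem tendsto_spectralSum (hβ : 0 < β)
    (hZE : ∀ N, Summable fun μ => Real.exp (-(β * ε N μ)))
    (hl : ∀ N n, (l N n).IsHermitian)
    (hlvar : ∀ N n, Summable fun p : κ N × κ N =>
      Real.exp (-(β * ε N p.1)) * ‖l N n p.1 p.2‖ ^ 2)
    (hαlim : ∀ n m t s, Tendsto
      (fun N => envCorr β (ε N) (l N n) (l N m) t s) atTop (𝓝 (α n m (t - s))))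
    (hαdecay : ∀ n m, Integrable (α n m)) (n m : J) (E₁ E₂ : ℝ) :
    Tendsto (fun N => spectralSum β (ε N) (l N n) (l N m) E₁ E₂) atTop
      (𝓝 (lateSpectral β α n m E₁ E₂)) := by
  have h := tendsto_sign_mul_spectralSum hβ hZE hl hlvar hαlim hαdecay n m E₁ E₂ 1 (by norm_num)
  simp only [Complex.ofReal_one, one_mul] at h
  rwa [integral_spectralKernel hαdecay (limitCorr_neg hZE hl hlvar hαlim)] at h

/-- The KMS condition in the form of two expressions for the limit of the same spectral sum,
obtained from positive and from negative times. -/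
theorem lateSpectral_eq_neg (hβ : 0 < β)
    (hZE : ∀ N, Summable fun μ => Real.exp (-(β * ε N μ)))
    (hl : ∀ N n, (l N n).IsHermitian)
    (hlvar : ∀ N n, Summable fun p : κ N × κ N =>
      Real.exp (-(β * ε N p.1)) * ‖l N n p.1 p.2‖ ^ 2)
    (hαlim : ∀ n m t s, Tendsto
      (fun N => envCorr β (ε N) (l N n) (l N m) t s) atTop (𝓝 (α n m (t - s))))
    (hαdecay : ∀ n m, Integrable (α n m)) (n m : J) (E₁ E₂ : ℝ) :
    lateSpectral β α n m E₁ E₂ =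
      -(Complex.I * ((Real.exp (-(β * E₂)) : ℂ) *
          (starRingEnd ℂ) (lateCoeff (α n m) (E₁ - E₂)) -
        (Real.exp (-(β * E₁)) : ℂ) * lateCoeff (α n m) (E₂ - E₁))) := by
  have h := (tendsto_sign_mul_spectralSum hβ hZE hl hlvar hαlim hαdecay n m E₁ E₂ (-1)
    (by norm_num)).neg
  simp only [Complex.ofReal_neg, Complex.ofReal_one, neg_mul, one_mul, neg_neg] at h
  rw [integral_spectralKernel_neg hαdecay (limitCorr_neg hZE hl hlvar hαlim)] at h
  exact tendsto_nhds_unique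
    (tendsto_spectralSum hβ hZE hl hlvar hαlim hαdecay n m E₁ E₂) h

/-- The multivariate KMS relation, between the spectral functions of the limit. -/
theorem fourierT_kms (hβ : 0 < β)
    (hZE : ∀ N, Summable fun μ => Real.exp (-(β * ε N μ)))
    (hl : ∀ N n, (l N n).IsHermitian)
    (hlvar : ∀ N n, Summable fun p : κ N × κ N =>
      Real.exp (-(β * ε N p.1)) * ‖l N n p.1 p.2‖ ^ 2)
    (hαlim : ∀ n m t s, Tendsto
      (fun N => envCorr β (ε N) (l N n) (l N m) t s) atTop (𝓝 (α n m (t - s))))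
    (hαdecay : ∀ n m, Integrable (α n m)) (n m : J) (w : ℝ) :
    fourierT (α n m) w = fourierT (α m n) (-w) * (Real.exp (-(β * w)) : ℂ) := by
  have hconj := limitCorr_neg hZE hl hlvar hαlim
  have h := lateSpectral_eq_neg hβ hZE hl hlvar hαlim hαdecay n m 0 w
  rw [fourierT_eq_lateCoeff_add_conj (hαdecay n m) (hconj m n),
    fourierT_eq_lateCoeff_add_conj (hαdecay m n) (hconj n m)]
  rw [lateSpectral] at h
  simp only [mul_zero, neg_zero, Real.exp_zero, Complex.ofReal_one, one_mul, zero_sub,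
    sub_zero] at h
  have h2 := mul_left_cancel₀ Complex.I_ne_zero (h.trans (mul_neg _ _).symm)
  linear_combination -h2

theorem fourierT_conj (hconj : ∀ n m t, α m n (-t) = (starRingEnd ℂ) (α n m t)) (n m : J)
    (w : ℝ) : fourierT (α m n) w = (starRingEnd ℂ) (fourierT (α n m) w) := by
  rw [fourierT, fourierT, ← integral_conj,
    ← integral_neg_eq_self (fun t : ℝ => Complex.exp (-(Complex.I * w * t)) * α m n t)]
  congr 1; ext t
  rw [hconj, map_mul, ← Complex.exp_conj]
  congr 2
  simp

end Limit

/-! ### The Dyson series through second order -/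

section Dyson

variable {a : Type*} [DecidableEq a] (E : a → ℝ) (V : Matrix a a ℂ)

lemma dyson_one (t : ℝ) (x y : a) :
    dyson E V 1 t x y = -(V x y * (boltzmannConv t (E x) (E y) : ℂ)) := by
  simp only [dyson, mmul_boltzmann_right, boltzmannConv]
  rw [← intervalIntegral.integral_ofReal, ← intervalIntegral.integral_const_mul]
  congr 2; ext s
  push_cast; ring

/-- A Boltzmann factor at an intermediate inverse temperature. -/
lemma exp_neg_mul_le_one_add {s t : ℝ} (hs : 0 ≤ s) (hst : s ≤ t) (e : ℝ) :
    Real.exp (-(s * e)) ≤ 1 + Real.exp (-(t * e)) := by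
  rcases le_total 0 e with h | h
  · have h1 : Real.exp (-(s * e)) ≤ 1 := Real.exp_le_one_iff.2 (by nlinarith)
    have := Real.exp_pos (-(t * e))
    linarith
  · have h1 : Real.exp (-(s * e)) ≤ Real.exp (-(t * e)) := Real.exp_le_exp.2 (by nlinarith)
    linarith

lemma dyson_two [Countable a] (t : ℝ) (ht : 0 ≤ t) (M : ℝ)
    (hM : ∀ z, Real.exp (-(t * E z)) ≤ M) (x y : a)
    (hV : Summable fun z => ‖V x z * V z y‖) :
    dyson E V 2 t x y = ∑' z, V x z * V z y *
      ((∫ s in (0 : ℝ)..t, Real.exp (-((t - s) * E x)) * boltzmannConv s (E z) (E y) : ℝ) : ℂ)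
      := by
  have hM0 : 0 ≤ M := (Real.exp_pos _).le.trans (hM x)
  set C : ℝ := (1 + M) * (t * (2 * (1 + M))) with hC
  have hbound : ∀ z, ∀ s ∈ Set.uIoc 0 t,
      |Real.exp (-((t - s) * E x)) * boltzmannConv s (E z) (E y)| ≤ C := by
    intro z s hs
    rw [Set.uIoc_of_le ht] at hs
    have hs0 : 0 ≤ s := hs.1.le
    rw [abs_mul, abs_of_pos (Real.exp_pos _), abs_of_nonneg (boltzmannConv_nonneg hs0 _ _)]
    have h1 : Real.exp (-((t - s) * E x)) ≤ 1 + M :=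
      (exp_neg_mul_le_one_add (by linarith [hs.2]) (by linarith) _).trans
        (add_le_add le_rfl (hM x))
    have h2 : ∀ w, Real.exp (-(s * E w)) ≤ 1 + M := fun w =>
      (exp_neg_mul_le_one_add hs0 hs.2 _).trans (add_le_add le_rfl (hM w))
    have h3 : boltzmannConv s (E z) (E y) ≤ t * (2 * (1 + M)) :=
      (boltzmannConv_le hs0 _ _).trans
        (mul_le_mul hs.2 (by linarith [h2 z, h2 y]) (by positivity) ht)
    exact mul_le_mul h1 h3 (boltzmannConv_nonneg hs0 _ _) (by positivity)
  have hcont : ∀ z, Continuous fun s : ℝ =>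
      Real.exp (-((t - s) * E x)) * boltzmannConv s (E z) (E y) := fun z =>
    Continuous.mul (by fun_prop) (continuous_boltzmannConv _ _)
  have hFb : ∀ z, ∀ s ∈ Set.uIoc 0 t, ‖V x z * V z y *
      ((Real.exp (-((t - s) * E x)) * boltzmannConv s (E z) (E y) : ℝ) : ℂ)‖ ≤
      ‖V x z * V z y‖ * C := by
    intro z s hs
    rw [norm_mul, Complex.norm_real, Real.norm_eq_abs]
    exact mul_le_mul_of_nonneg_left (hbound z s hs) (norm_nonneg _)
  have hsum : ∀ s ∈ Set.uIoc 0 t, Summable fun z => V x z * V z y *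
      ((Real.exp (-((t - s) * E x)) * boltzmannConv s (E z) (E y) : ℝ) : ℂ) := fun s hs =>
    Summable.of_norm_bounded (hV.mul_right C) fun z => hFb z s hs
  have key := intervalIntegral.hasSum_integral_of_dominated_convergence (μ := volume)
    (a := 0) (b := t)
    (F := fun z s => V x z * V z y *
      ((Real.exp (-((t - s) * E x)) * boltzmannConv s (E z) (E y) : ℝ) : ℂ))
    (f := fun s => ∑' z, V x z * V z y *
      ((Real.exp (-((t - s) * E x)) * boltzmannConv s (E z) (E y) : ℝ) : ℂ))
    (fun z _ => ‖V x z * V z y‖ * C)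
    (fun z => Continuous.aestronglyMeasurable
      (continuous_const.mul (Complex.continuous_ofReal.comp (hcont z))))
    (fun z => Eventually.of_forall fun s hs => hFb z s hs)
    (Eventually.of_forall fun s _ => hV.mul_right C)
    intervalIntegrable_const
    (Eventually.of_forall fun s hs => (hsum s hs).hasSum)
  have h2 : ∀ z, (∫ s in (0 : ℝ)..t, V x z * V z y *
      ((Real.exp (-((t - s) * E x)) * boltzmannConv s (E z) (E y) : ℝ) : ℂ)) =
      V x z * V z y * ((∫ s in (0 : ℝ)..t,
        Real.exp (-((t - s) * E x)) * boltzmannConv s (E z) (E y) : ℝ) : ℂ) := fun z => by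
    rw [intervalIntegral.integral_const_mul, intervalIntegral.integral_ofReal]
  simp_rw [h2] at key
  have h3 : dyson E V 2 t x y =
      -∫ s in (0 : ℝ)..t, (Real.exp (-((t - s) * E x)) : ℂ) * mmul V (dyson E V 1 s) x y := rfl
  rw [key.tsum_eq, h3, ← intervalIntegral.integral_neg]
  congr 1; ext s
  simp only [mmul, dyson_one]
  rw [← tsum_mul_left, ← tsum_neg]
  congr 1; ext z
  push_cast; ring

end Dyson

/-! ### The reduced thermal state through second order -/

lemma interaction_apply {ι κ J : Type*} [Fintype J] (L : J → Matrix ι ι ℂ)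
    (l : J → Matrix κ κ ℂ) (x y : ι × κ) :
    interaction L l x y = ∑ n, L n x.1 y.1 * l n x.2 y.2 := by
  simp [interaction, Matrix.sum_apply, Matrix.kronecker]

lemma boltzmannConv_add_add (t A B c : ℝ) :
    boltzmannConv t (A + c) (B + c) = Real.exp (-(t * c)) * boltzmannConv t A B := by
  rw [boltzmannConv, boltzmannConv, ← intervalIntegral.integral_const_mul]
  congr 1; ext s
  rw [← Real.exp_add, ← Real.exp_add, ← Real.exp_add]
  congr 1; ring

lemma norm_mul_apply_le {a : Type*} {X : Matrix a a ℂ} (hX : X.IsHermitian) (Y : Matrix a a ℂ)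
    (i k j : a) : ‖X i k * Y k j‖ ≤ ‖X k i‖ ^ 2 + ‖Y k j‖ ^ 2 := by
  rw [norm_mul, norm_apply_swap hX i k]
  nlinarith [sq_nonneg (‖X k i‖ - ‖Y k j‖), sq_nonneg ‖X k i‖, sq_nonneg ‖Y k j‖]

section Estimates

variable {ι κ J : Type*} {β : ℝ} {ω : ι → ℝ} {ε : κ → ℝ} {L : J → Matrix ι ι ℂ}
  {l : J → Matrix κ κ ℂ}

lemma summable_exp_mul_diag (hZE : Summable fun μ => Real.exp (-(β * ε μ))) {x : Matrix κ κ ℂ}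
    (hxv : Summable fun p : κ × κ => Real.exp (-(β * ε p.1)) * ‖x p.1 p.2‖ ^ 2) :
    Summable fun μ => (Real.exp (-(β * ε μ)) : ℂ) * x μ μ := by
  have h1 : Summable fun μ => Real.exp (-(β * ε μ)) * ‖x μ μ‖ ^ 2 :=
    hxv.comp_injective (i := fun μ : κ => (μ, μ)) fun _ _ h => (Prod.mk.inj h).1
  refine Summable.of_norm_bounded (hZE.add h1) fun μ => ?_
  rw [norm_mul, Complex.norm_real, Real.norm_eq_abs, abs_of_pos (Real.exp_pos _)]
  have := Real.exp_pos (-(β * ε μ))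
  nlinarith [sq_nonneg (‖x μ μ‖ - 1), sq_nonneg ‖x μ μ‖]

/-- A sum over the diagonal of a centred environment coupling vanishes. -/
lemma hasSum_exp_mul_diag [DecidableEq κ] [Nonempty κ]
    (hZE : Summable fun μ => Real.exp (-(β * ε μ))) {x : Matrix κ κ ℂ}
    (hxv : Summable fun p : κ × κ => Real.exp (-(β * ε p.1)) * ‖x p.1 p.2‖ ^ 2)
    (hx : thermalMean β ε x = 0) :
    HasSum (fun μ => (Real.exp (-(β * ε μ)) : ℂ) * x μ μ) 0 := by
  have h := (summable_exp_mul_diag hZE hxv).hasSum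
  convert h using 1
  have hZ0 : tr (boltzmann ε β) ≠ 0 := tr_boltzmann_ne_zero hZE
  have h2 := (div_eq_zero_iff.1 hx).resolve_right hZ0
  rw [← h2, tr]
  congr 1; ext μ
  rw [mmul_boltzmann_left]

lemma exp_le_tsum {a : Type*} {E : a → ℝ} (h : Summable fun i => Real.exp (-(β * E i))) (i : a) :
    Real.exp (-(β * E i)) ≤ ∑' i, Real.exp (-(β * E i)) :=
  h.le_tsum i fun _ _ => (Real.exp_pos _).le

lemma shiftBound_le (hβ : 0 < β) (hZS : Summable fun i => Real.exp (-(β * ω i))) (e : ℝ) (k : ι) :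
    shiftBound β e (ω k) ≤ (β + 1) * (Real.exp (-(β * e)) + ∑' i, Real.exp (-(β * ω i))) :=
  mul_le_mul_of_nonneg_left (add_le_add le_rfl (exp_le_tsum hZS k)) (by positivity)

lemma summable_norm_mul_apply (hL : ∀ n, (L n).IsHermitian)
    (hLdom : ∀ n j, Summable fun k => ‖L n k j‖ ^ 2) (n m : J) (i j : ι) :
    Summable fun k => ‖L n i k * L m k j‖ :=
  Summable.of_nonneg_of_le (fun _ => norm_nonneg _)
    (fun k => norm_mul_apply_le (hL n) (L m) i k j) ((hLdom n i).add (hLdom m j))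

lemma interaction_mul_interaction [Fintype J] (x z y : ι × κ) :
    interaction L l x z * interaction L l z y =
      ∑ n, ∑ m, (L n x.1 z.1 * L m z.1 y.1) * (l n x.2 z.2 * l m z.2 y.2) := by
  rw [interaction_apply, interaction_apply, Finset.sum_mul_sum]
  refine Finset.sum_congr rfl fun n _ => Finset.sum_congr rfl fun m _ => ?_
  ring

/-- One term of the second-order coefficient, labelled by the intermediate system level `k` and a
pair `(μ, ν)` of environment levels. -/
def secondOrderTerm (β : ℝ) (ω : ι → ℝ) (ε : κ → ℝ) (L : J → Matrix ι ι ℂ)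
    (l : J → Matrix κ κ ℂ) (i j : ι) (n m : J) (q : ι × (κ × κ)) : ℂ :=
  L n i q.1 * L m q.1 j * ((l n q.2.1 q.2.2 * l m q.2.2 q.2.1 *
      (boltzmannConv β (ω i + ε q.2.1) (ω q.1 + ε q.2.2) : ℂ) -
    l n q.2.1 q.2.2 * l m q.2.2 q.2.1 *
      (boltzmannConv β (ω j + ε q.2.1) (ω q.1 + ε q.2.2) : ℂ)) / (ω j - ω i))

lemma summable_secondOrderTerm (hβ : 0 < β) (hZS : Summable fun i => Real.exp (-(β * ω i)))
    (hL : ∀ n, (L n).IsHermitian) (hLdom : ∀ n j, Summable fun k => ‖L n k j‖ ^ 2)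
    (hl : ∀ n, (l n).IsHermitian)
    (hlvar : ∀ n, Summable fun p : κ × κ => Real.exp (-(β * ε p.1)) * ‖l n p.1 p.2‖ ^ 2)
    (i j : ι) (n m : J) : Summable (secondOrderTerm β ω ε L l i j n m) := by
  set B : ℝ → ℝ := fun e =>
    (β + 1) * (Real.exp (-(β * e)) + ∑' i, Real.exp (-(β * ω i))) with hB
  have hB0 : ∀ e, 0 ≤ B e := fun e => (shiftBound_nonneg hβ e (ω i)).trans
    (shiftBound_le hβ hZS e i)
  set C : ℝ := (B (ω i) + B (ω j)) / ‖(ω j : ℂ) - ω i‖ with hC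
  have hC0 : 0 ≤ C := div_nonneg (add_nonneg (hB0 _) (hB0 _)) (norm_nonneg _)
  have h1 := (summable_norm_mul_apply hL hLdom n m i j).mul_of_nonneg
    ((summable_spectralWeight (hl n) (hl m) (hlvar n) (hlvar m)).mul_left C)
    (fun _ => norm_nonneg _) (fun p => mul_nonneg hC0
      (spectralWeight_nonneg β ε (l n) (l m) p))
  refine Summable.of_norm_bounded h1 fun q => ?_
  rw [secondOrderTerm, norm_mul]
  refine mul_le_mul_of_nonneg_left ?_ (norm_nonneg _)
  rw [norm_div, hC, div_mul_eq_mul_div, add_mul]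
  refine div_le_div_of_nonneg_right ((norm_sub_le _ _).trans (add_le_add ?_ ?_)) (norm_nonneg _)
  · exact (norm_mul_mul_boltzmannConv_le hβ ε (l n) (hl m) _ _ _).trans
      (mul_le_mul_of_nonneg_right (shiftBound_le hβ hZS _ _) (spectralWeight_nonneg _ _ _ _ _))
  · exact (norm_mul_mul_boltzmannConv_le hβ ε (l n) (hl m) _ _ _).trans
      (mul_le_mul_of_nonneg_right (shiftBound_le hβ hZS _ _) (spectralWeight_nonneg _ _ _ _ _))

lemma tsum_secondOrderTerm [DecidableEq κ] [Nonempty κ] (hβ : 0 < β)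
    (hZE : Summable fun μ => Real.exp (-(β * ε μ)))
    (hl : ∀ n, (l n).IsHermitian)
    (hlvar : ∀ n, Summable fun p : κ × κ => Real.exp (-(β * ε p.1)) * ‖l n p.1 p.2‖ ^ 2)
    (i j k : ι) (n m : J) :
    ∑' p, secondOrderTerm β ω ε L l i j n m (k, p) = tr (boltzmann ε β) *
      (L n i k * L m k j *
        ((spectralSum β ε (l n) (l m) (ω i) (ω k) - spectralSum β ε (l n) (l m) (ω j) (ω k)) /
          (ω j - ω i))) := by
  have hZ0 : tr (boltzmann ε β) ≠ 0 := tr_boltzmann_ne_zero hZE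
  have hs : ∀ E₁ E₂, Summable fun p : κ × κ => l n p.1 p.2 * l m p.2 p.1 *
      (boltzmannConv β (E₁ + ε p.1) (E₂ + ε p.2) : ℂ) := fun E₁ E₂ =>
    Summable.of_norm_bounded
      ((summable_spectralWeight (hl n) (hl m) (hlvar n) (hlvar m)).mul_left _)
      fun p => norm_mul_mul_boltzmannConv_le hβ ε (l n) (hl m) E₁ E₂ p
  rw [spectralSum, spectralSum, ← sub_div, ← (hs _ _).tsum_sub (hs _ _)]
  dsimp only [secondOrderTerm]
  rw [tsum_mul_left, tsum_div_const]
  generalize (∑' p : κ × κ, (l n p.1 p.2 * l m p.2 p.1 *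
      (boltzmannConv β (ω i + ε p.1) (ω k + ε p.2) : ℂ) -
    l n p.1 p.2 * l m p.2 p.1 *
      (boltzmannConv β (ω j + ε p.1) (ω k + ε p.2) : ℂ))) = S
  rw [div_right_comm, mul_left_comm, mul_div_cancel₀ _ hZ0]

lemma summable_interaction_mul_interaction [Fintype J] (hL : ∀ n, (L n).IsHermitian)
    (hLdom : ∀ n j, Summable fun k => ‖L n k j‖ ^ 2) (hl : ∀ n, (l n).IsHermitian)
    (hlvar : ∀ n, Summable fun p : κ × κ => Real.exp (-(β * ε p.1)) * ‖l n p.1 p.2‖ ^ 2)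
    (i j : ι) (μ : κ) :
    Summable fun z => ‖interaction L l (i, μ) z * interaction L l z (j, μ)‖ := by
  have hcol : ∀ n μ, Summable fun ν => ‖l n ν μ‖ ^ 2 := by
    intro n μ
    have h1 : Summable fun ν => Real.exp (-(β * ε μ)) * ‖l n μ ν‖ ^ 2 :=
      (hlvar n).comp_injective (i := fun ν : κ => (μ, ν)) fun _ _ h => (Prod.mk.inj h).2
    refine ((summable_mul_left_iff (Real.exp_pos _).ne').1 h1).congr fun ν => ?_
    rw [norm_apply_swap (hl n)]
  have h2 : Summable fun z : ι × κ => ∑ n, ∑ m,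
      ‖L n i z.1 * L m z.1 j‖ * ‖l n μ z.2 * l m z.2 μ‖ :=
    summable_sum fun n _ => summable_sum fun m _ =>
      (summable_norm_mul_apply hL hLdom n m i j).mul_of_nonneg
        (summable_norm_mul_apply hl hcol n m μ μ) (fun _ => norm_nonneg _)
        fun _ => norm_nonneg _
  refine Summable.of_nonneg_of_le (fun _ => norm_nonneg _) (fun z => ?_) h2
  rw [interaction_mul_interaction]
  refine (norm_sum_le _ _).trans (Finset.sum_le_sum fun n _ => (norm_sum_le _ _).trans
    (Finset.sum_le_sum fun m _ => ?_))
  rw [norm_mul]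

end Estimates

section Reduced

variable {ι κ J : Type*} [DecidableEq ι] [DecidableEq κ] [Fintype J]
  {β : ℝ} {ω : ι → ℝ} {ε : κ → ℝ} {L : J → Matrix ι ι ℂ} {l : J → Matrix κ κ ℂ}

lemma trEnv_closedGibbs_zero (i j : ι) :
    trEnv (closedGibbs β ω ε L l 0) i j = boltzmann ω β i j * tr (boltzmann ε β) := by
  rw [trEnv, tr, ← tsum_mul_left]
  congr 1; ext μ
  simp only [closedGibbs, dyson, boltzmann, Matrix.diagonal_apply, Prod.mk.injEq, and_true]
  split_ifs with h
  · subst h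
    rw [mul_add, neg_add, Real.exp_add]; push_cast; ring
  · simp

lemma tr_closedGibbs_zero (hZS : Summable fun i => Real.exp (-(β * ω i)))
    (hZE : Summable fun μ => Real.exp (-(β * ε μ))) :
    tr (closedGibbs β ω ε L l 0) = tr (boltzmann ω β) * tr (boltzmann ε β) := by
  rw [tr_boltzmann, tr_boltzmann, ← Complex.ofReal_mul,
    hZS.tsum_mul_tsum hZE (hZS.mul_of_nonneg hZE (fun _ => (Real.exp_pos _).le)
      fun _ => (Real.exp_pos _).le), Complex.ofReal_tsum]
  rw [tr]
  congr 1; ext x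
  simp only [closedGibbs, dyson, boltzmann, Matrix.diagonal_apply_eq]
  rw [mul_add, neg_add, Real.exp_add]

lemma closedGibbs_two_apply (hβ : 0 < β) (hZS : Summable fun i => Real.exp (-(β * ω i)))
    (hL : ∀ n, (L n).IsHermitian) (hLdom : ∀ n j, Summable fun k => ‖L n k j‖ ^ 2)
    (hZE : Summable fun μ => Real.exp (-(β * ε μ))) (hl : ∀ n, (l n).IsHermitian)
    (hlvar : ∀ n, Summable fun p : κ × κ => Real.exp (-(β * ε p.1)) * ‖l n p.1 p.2‖ ^ 2)
    {i j : ι} (hij : ω i ≠ ω j) (μ : κ) :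
    closedGibbs β ω ε L l 2 (i, μ) (j, μ) =
      ∑' z : ι × κ, ∑ n, ∑ m, secondOrderTerm β ω ε L l i j n m (z.1, (μ, z.2)) := by
  have hcι := countable_of_summable_exp β ω hZS
  have hcκ := countable_of_summable_exp β ε hZE
  -- the energies are bounded below, since their Boltzmann factors are summable
  have hM : ∀ x : ι × κ, Real.exp (-(β * (ω x.1 + ε x.2))) ≤
      (∑' i, Real.exp (-(β * ω i))) * ∑' μ, Real.exp (-(β * ε μ)) := by
    intro x
    rw [mul_add, neg_add, Real.exp_add]
    exact mul_le_mul (exp_le_tsum hZS _) (exp_le_tsum hZE _) (Real.exp_pos _).le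
      (tsum_nonneg fun _ => (Real.exp_pos _).le)
  have h1 : closedGibbs β ω ε L l 2 (i, μ) (j, μ) = _ :=
    dyson_two _ _ β hβ.le _ hM _ _ (summable_interaction_mul_interaction hL hLdom hl hlvar i j μ)
  rw [h1]
  refine tsum_congr fun z => ?_
  rw [integral_exp_mul_boltzmannConv _ _ _ _ (by simpa using hij), interaction_mul_interaction,
    Finset.sum_mul]
  refine Finset.sum_congr rfl fun n _ => ?_
  rw [Finset.sum_mul]
  refine Finset.sum_congr rfl fun m _ => ?_
  dsimp only [secondOrderTerm]
  push_cast
  rw [add_sub_add_right_eq_sub]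
  ring

variable [Nonempty κ]

lemma hasSum_closedGibbs_one (hZE : Summable fun μ => Real.exp (-(β * ε μ)))
    (hlvar : ∀ n, Summable fun p : κ × κ => Real.exp (-(β * ε p.1)) * ‖l n p.1 p.2‖ ^ 2)
    (hlmean : ∀ n, thermalMean β ε (l n) = 0) (i j : ι) :
    HasSum (fun μ => closedGibbs β ω ε L l 1 (i, μ) (j, μ)) 0 := by
  have h := hasSum_sum (s := Finset.univ) (fun n _ =>
    (hasSum_exp_mul_diag hZE (hlvar n) (hlmean n)).mul_left
      (-(L n i j * (boltzmannConv β (ω i) (ω j) : ℂ))))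
  simp only [mul_zero, Finset.sum_const_zero] at h
  refine HasSum.congr_fun h fun μ => ?_
  have h1 : closedGibbs β ω ε L l 1 (i, μ) (j, μ) = _ := dyson_one _ _ _ _ _
  rw [h1, interaction_apply, boltzmannConv_add_add, Finset.sum_mul,
    ← Finset.sum_neg_distrib]
  refine Finset.sum_congr rfl fun n _ => ?_
  push_cast; ring

lemma trEnv_closedGibbs_one (hZE : Summable fun μ => Real.exp (-(β * ε μ)))
    (hlvar : ∀ n, Summable fun p : κ × κ => Real.exp (-(β * ε p.1)) * ‖l n p.1 p.2‖ ^ 2)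
    (hlmean : ∀ n, thermalMean β ε (l n) = 0) (i j : ι) :
    trEnv (closedGibbs β ω ε L l 1) i j = 0 :=
  (hasSum_closedGibbs_one hZE hlvar hlmean i j).tsum_eq

/-- The first-order coefficient of the partition function vanishes, also when its trace does not
converge absolutely: the sum then has the junk value zero. -/
lemma tr_closedGibbs_one (hZE : Summable fun μ => Real.exp (-(β * ε μ)))
    (hlvar : ∀ n, Summable fun p : κ × κ => Real.exp (-(β * ε p.1)) * ‖l n p.1 p.2‖ ^ 2)
    (hlmean : ∀ n, thermalMean β ε (l n) = 0) :
    tr (closedGibbs β ω ε L l 1) = 0 := by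
  rw [tr]
  by_cases hs : Summable fun x => closedGibbs β ω ε L l 1 x x
  · rw [hs.tsum_prod]
    simp_rw [(hasSum_closedGibbs_one hZE hlvar hlmean _ _).tsum_eq, tsum_zero]
  · exact tsum_eq_zero_of_not_summable hs

/-- The second-order coefficient of the reduced Gibbs operator off the diagonal. -/
theorem trEnv_closedGibbs_two (hβ : 0 < β) (hZS : Summable fun i => Real.exp (-(β * ω i)))
    (hL : ∀ n, (L n).IsHermitian) (hLdom : ∀ n j, Summable fun k => ‖L n k j‖ ^ 2)
    (hZE : Summable fun μ => Real.exp (-(β * ε μ))) (hl : ∀ n, (l n).IsHermitian)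
    (hlvar : ∀ n, Summable fun p : κ × κ => Real.exp (-(β * ε p.1)) * ‖l n p.1 p.2‖ ^ 2)
    {i j : ι} (hij : ω i ≠ ω j) :
    trEnv (closedGibbs β ω ε L l 2) i j = tr (boltzmann ε β) *
      ∑' k, ∑ n, ∑ m, L n i k * L m k j *
        ((spectralSum β ε (l n) (l m) (ω i) (ω k) - spectralSum β ε (l n) (l m) (ω j) (ω k)) /
          (ω j - ω i)) := by
  have hFs := summable_secondOrderTerm hβ hZS hL hLdom hl hlvar i j
  have hterm := tsum_secondOrderTerm (ω := ω) (L := L) hβ hZE hl hlvar i j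
  rw [trEnv, tsum_congr fun μ => closedGibbs_two_apply hβ hZS hL hLdom hZE hl hlvar hij μ]
  generalize secondOrderTerm β ω ε L l i j = F at hFs hterm ⊢
  have hG : Summable fun q => ∑ n, ∑ m, F n m q :=
    summable_sum fun n _ => summable_sum fun m _ => hFs n m
  -- the pairs `(μ, (k, ν))` are regrouped as `(k, (μ, ν))`
  let e : κ × (ι × κ) ≃ ι × (κ × κ) :=
    { toFun := fun q => (q.2.1, (q.1, q.2.2))
      invFun := fun q => (q.2.1, (q.1, q.2.2))
      left_inv := fun _ => rfl
      right_inv := fun _ => rfl }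
  have hGe : Summable fun q : κ × (ι × κ) => ∑ n, ∑ m, F n m (q.2.1, (q.1, q.2.2)) :=
    (e.summable_iff).2 hG
  have h1 := hGe.tsum_prod
  have h2 : ∑' q : κ × (ι × κ), ∑ n, ∑ m, F n m (q.2.1, (q.1, q.2.2)) =
    ∑' q, ∑ n, ∑ m, F n m q := e.tsum_eq (fun q => ∑ n, ∑ m, F n m q)
  rw [← h1, h2, hG.tsum_prod, ← tsum_mul_left]
  refine tsum_congr fun k => ?_
  have hFk : ∀ n m, Summable fun p => F n m (k, p) := fun n m =>
    (hFs n m).comp_injective (Prod.mk_right_injective k)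
  rw [Summable.tsum_finsetSum (fun n _ => summable_sum fun m _ => hFk n m), Finset.mul_sum]
  refine Finset.sum_congr rfl fun n _ => ?_
  rw [Summable.tsum_finsetSum (fun m _ => hFk n m), Finset.mul_sum]
  exact Finset.sum_congr rfl fun m _ => hterm k n m

end Reduced

/-! ### The master equation at second order -/

section MasterEquation

variable {ι J : Type*} {ω : ι → ℝ} {L : J → Matrix ι ι ℂ} {α : J → J → ℝ → ℂ} {β : ℝ}

lemma tendsto_diamond {f : ℝ → ℂ} (hf : Integrable f) (ω : ι → ℝ) (X : Matrix ι ι ℂ) (i k : ι) :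
    Tendsto (fun t => diamond ω f X t i k) atTop (𝓝 (lateDiamond ω f X i k)) := by
  have h := (intervalIntegral_tendsto_integral_Ioi (0 : ℝ)
    (lateCoeff_integrableOn hf (ω i - ω k)) tendsto_id).mul_const (X i k)
  rw [lateDiamond, lateCoeff]
  refine h.congr fun t => ?_
  have h2 := intervalIntegral.integral_comp_sub_left (a := 0) (b := t)
    (fun τ : ℝ => Complex.exp (-(Complex.I * ((ω i - ω k : ℝ) : ℂ) * τ)) * f τ) t
  rw [sub_self, sub_zero] at h2
  rw [diamond, id, ← h2, ← intervalIntegral.integral_mul_const]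
  congr 1; ext s
  rw [freeProp, heisenberg]
  have : Complex.exp (-(Complex.I * ((ω i - ω k : ℝ) : ℂ) * ((t - s : ℝ) : ℂ))) =
      Complex.exp (Complex.I * ((-(t - s) : ℝ) : ℂ) * ω i) *
        Complex.exp (-(Complex.I * ((-(t - s) : ℝ) : ℂ) * ω k)) := by
    rw [← Complex.exp_add]
    congr 1
    push_cast; ring
  rw [this]; ring

variable [DecidableEq ι]

lemma liouville0_apply (ρ : Matrix ι ι ℂ) (i j : ι) :
    liouville0 ω ρ i j = -Complex.I * (((ω i : ℂ) - ω j) * ρ i j) := by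
  rw [liouville0, Matrix.smul_apply, comm, Matrix.sub_apply, ham, mmul_diagonal_left,
    mmul_diagonal_right, smul_eq_mul]
  ring

lemma thermal_eq_diagonal : thermal β ω =
    Matrix.diagonal fun i => (Real.exp (-(β * ω i)) : ℂ) / tr (boltzmann ω β) := by
  ext i j
  by_cases h : i = j
  · subst h; simp [thermal, boltzmann]
  · simp [thermal, boltzmann, h]

/-- The matrix elements of `𝓛₂` applied to the thermal state.  The KMS condition brings the
four late-time coefficients of each term into the form of a difference of two spectral limits, so
that the diagonal vanishes: detailed balance. -/
theorem lateLiouville2_thermal [Fintype J] (hZS : Summable fun i => Real.exp (-(β * ω i)))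
    (hL : ∀ n, (L n).IsHermitian) (hLdom : ∀ n j, Summable fun k => ‖L n k j‖ ^ 2)
    (hαdecay : ∀ n m, Integrable (α n m))
    (hkms : ∀ n m E₁ E₂, lateSpectral β α n m E₁ E₂ =
      -(Complex.I * ((Real.exp (-(β * E₂)) : ℂ) *
          (starRingEnd ℂ) (lateCoeff (α n m) (E₁ - E₂)) -
        (Real.exp (-(β * E₁)) : ℂ) * lateCoeff (α n m) (E₂ - E₁)))) (i j : ι) :
    lateLiouville2 ω L α (thermal β ω) i j = -Complex.I / tr (boltzmann ω β) *
      ∑' k, ∑ n, ∑ m, L n i k * L m k j *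
        (lateSpectral β α n m (ω i) (ω k) - lateSpectral β α n m (ω j) (ω k)) := by
  have : Nonempty ι := ⟨i⟩
  have hzpos := tsum_exp_pos β ω hZS
  set z : ℂ := tr (boltzmann ω β) with hz
  have hzr : z = ((∑' i, Real.exp (-(β * ω i)) : ℝ) : ℂ) := tr_boltzmann _ _
  have hz0 : z ≠ 0 := by rw [hzr]; exact_mod_cast hzpos.ne'
  set p : ι → ℂ := fun k => (Real.exp (-(β * ω k)) : ℂ) / z with hp
  have hp1 : ∀ k, ‖p k‖ ≤ 1 := by
    intro k
    rw [hp, hzr, norm_div, Complex.norm_real, Complex.norm_real, Real.norm_eq_abs,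
      Real.norm_eq_abs, abs_of_pos (Real.exp_pos _), abs_of_pos hzpos]
    exact (div_le_one hzpos).2 (exp_le_tsum hZS k)
  -- the matrix elements of `ρ (A ⋄ L)† - (A ⋄ L) ρ`, relative to those of the coupling
  set c : J → J → ι → ι → ℂ := fun n m i k =>
    p i * (starRingEnd ℂ) (lateCoeff (α n m) (ω k - ω i)) -
      lateCoeff (α n m) (ω i - ω k) * p k with hc
  have hX : ∀ n m i k, (mmul (thermal β ω) (lateDiamond ω (α n m) (L m)).conjTranspose -
      mmul (lateDiamond ω (α n m) (L m)) (thermal β ω)) i k = c n m i k * L m i k := by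
    intro n m i k
    rw [Matrix.sub_apply, thermal_eq_diagonal, mmul_diagonal_left, mmul_diagonal_right,
      Matrix.conjTranspose_apply, lateDiamond, lateDiamond, star_mul', (hL m).apply i k,
      Complex.star_def]
    simp only [hc, hp]
    ring
  have hcb : ∀ n m i k, ‖c n m i k‖ ≤ (∫ t, ‖α n m t‖) + ∫ t, ‖α n m t‖ := by
    intro n m i k
    refine (norm_sub_le _ _).trans (add_le_add ?_ ?_)
    · rw [norm_mul, RCLike.norm_conj]
      exact (mul_le_of_le_one_left (norm_nonneg _) (hp1 i)).trans
        (norm_lateCoeff_le (hαdecay n m) _)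
    · rw [norm_mul]
      exact (mul_le_of_le_one_right (norm_nonneg _) (hp1 k)).trans
        (norm_lateCoeff_le (hαdecay n m) _)
  have hsum : ∀ (n m n' m' : J) (d : ι → ι × ι),
      Summable fun k => L n i k * L m k j * c n' m' (d k).1 (d k).2 := by
    intro n m n' m' d
    refine Summable.of_norm_bounded
      ((summable_norm_mul_apply hL hLdom n m i j).mul_right
        ((∫ t, ‖α n' m' t‖) + ∫ t, ‖α n' m' t‖)) fun k => ?_
    rw [norm_mul]
    exact mul_le_mul_of_nonneg_left (hcb _ _ _ _) (norm_nonneg _)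
  have hcomm : ∀ n m, comm (L n) (mmul (thermal β ω)
      (lateDiamond ω (α n m) (L m)).conjTranspose -
      mmul (lateDiamond ω (α n m) (L m)) (thermal β ω)) i j =
      ∑' k, L n i k * L m k j * c n m k j - ∑' k, L m i k * L n k j * c n m i k := by
    intro n m
    rw [comm, Matrix.sub_apply, mmul, mmul]
    simp_rw [hX]
    congr 1 <;> refine tsum_congr fun k => ?_ <;> ring
  have hterm : ∀ n m k, c n m k j - c m n i k = -Complex.I / z *
      (lateSpectral β α n m (ω i) (ω k) - lateSpectral β α n m (ω j) (ω k)) := by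
    intro n m k
    rw [hkms n m (ω j) (ω k), lateSpectral]
    simp only [hc, hp]
    have hI := Complex.I_mul_I
    field_simp
    linear_combination (((Real.exp (-(β * ω k)) : ℂ) * lateCoeff (α m n) (ω i - ω k) -
      (Real.exp (-(β * ω i)) : ℂ) * (starRingEnd ℂ) (lateCoeff (α m n) (ω k - ω i))) +
      ((Real.exp (-(β * ω k)) : ℂ) * (starRingEnd ℂ) (lateCoeff (α n m) (ω j - ω k)) -
      (Real.exp (-(β * ω j)) : ℂ) * lateCoeff (α n m) (ω k - ω j))) * hI
  rw [lateLiouville2, liouville2, Matrix.sum_apply]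
  simp_rw [Matrix.sum_apply, hcomm, Finset.sum_sub_distrib]
  rw [Finset.sum_comm (f := fun n m => ∑' k, L m i k * L n k j * c n m i k),
    ← Finset.sum_sub_distrib, ← tsum_mul_left]
  simp_rw [← Finset.sum_sub_distrib]
  have hs1 : ∀ n m, Summable fun k => L n i k * L m k j * c n m k j := fun n m =>
    hsum n m n m fun k => (k, j)
  have hs2 : ∀ n m, Summable fun k => L n i k * L m k j * c m n i k := fun n m =>
    hsum n m m n fun k => (i, k)
  have hs3 : ∀ n m, Summable fun k => L n i k * L m k j * c n m k j -
      L n i k * L m k j * c m n i k := fun n m => (hs1 n m).sub (hs2 n m)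
  calc ∑ n, ∑ m, (∑' k, L n i k * L m k j * c n m k j - ∑' k, L n i k * L m k j * c m n i k)
      = ∑ n, ∑ m, ∑' k, (L n i k * L m k j * c n m k j - L n i k * L m k j * c m n i k) :=
        Finset.sum_congr rfl fun n _ => Finset.sum_congr rfl fun m _ =>
          ((hs1 n m).tsum_sub (hs2 n m)).symm
    _ = ∑' k, ∑ n, ∑ m,
          (L n i k * L m k j * c n m k j - L n i k * L m k j * c m n i k) := by
        rw [Summable.tsum_finsetSum fun n _ => summable_sum fun m _ => hs3 n m]
        refine Finset.sum_congr rfl fun n _ => ?_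
        rw [Summable.tsum_finsetSum fun m _ => hs3 n m]
    _ = _ := by
        refine tsum_congr fun k => ?_
        rw [Finset.mul_sum]
        refine Finset.sum_congr rfl fun n _ => ?_
        rw [Finset.mul_sum]
        refine Finset.sum_congr rfl fun m _ => ?_
        rw [← mul_sub, hterm]
        ring

end MasterEquation

/-! ### The reservoir limit of the second-order coefficient -/

section Convergence

variable {ι J : Type*} {κ : ℕ → Type*} [∀ N, DecidableEq (κ N)]
  [∀ N, Nonempty (κ N)] {β : ℝ} {ω : ι → ℝ} {L : J → Matrix ι ι ℂ} {ε : ∀ N, κ N → ℝ}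
  {l : ∀ N, J → Matrix (κ N) (κ N) ℂ} {α : J → J → ℝ → ℂ}

/-- Spectral sums are bounded uniformly along the reservoir limit, because the total spectral
weight is a sum of autocorrelations at time zero. -/
lemma exists_norm_spectralSum_le (hβ : 0 < β)
    (hZE : ∀ N, Summable fun μ => Real.exp (-(β * ε N μ)))
    (hl : ∀ N n, (l N n).IsHermitian)
    (hlvar : ∀ N n, Summable fun p : κ N × κ N =>
      Real.exp (-(β * ε N p.1)) * ‖l N n p.1 p.2‖ ^ 2)
    (hαlim : ∀ n m t s, Tendsto
      (fun N => envCorr β (ε N) (l N n) (l N m) t s) atTop (𝓝 (α n m (t - s)))) (n m : J) :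
    ∃ B, 0 ≤ B ∧ ∀ N E₁ E₂,
      ‖spectralSum β (ε N) (l N n) (l N m) E₁ E₂‖ ≤ shiftBound β E₁ E₂ * B := by
  have hlim : ∀ n, Tendsto (fun N => envCorr β (ε N) (l N n) (l N n) (-0) 0 +
      envCorr β (ε N) (l N n) (l N n) 0 0) atTop (𝓝 (α n n (-0 - 0) + α n n (0 - 0))) :=
    fun n => (hαlim n n (-0) 0).add (hαlim n n 0 0)
  obtain ⟨B, hB⟩ := ((hlim n).add (hlim m)).norm.bddAbove_range
  have hB' : ∀ N, (∑' p, spectralWeight β (ε N) (l N n) (l N m) p) /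
      (∑' μ, Real.exp (-(β * ε N μ))) ≤ B := by
    intro N
    have hz := tsum_exp_pos β (ε N) (hZE N)
    have h1 := (hasSum_spectralWeight (hZE N) (hl N n) (hl N m) (hlvar N n) (hlvar N m)
      0).tsum_eq
    simp only [Complex.ofReal_zero, mul_zero, zero_mul, neg_zero, Complex.exp_zero,
      mul_one] at h1
    rw [← Complex.ofReal_tsum, tr_boltzmann] at h1
    have h2 := hB (Set.mem_range_self N)
    simp only [neg_zero] at h2
    rw [div_le_iff₀ hz]
    have h3 := congrArg norm h1
    rw [norm_mul, Complex.norm_real, Complex.norm_real, Real.norm_eq_abs, Real.norm_eq_abs,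
      abs_of_pos hz] at h3
    calc _ ≤ |∑' p, spectralWeight β (ε N) (l N n) (l N m) p| := le_abs_self _
      _ = _ := h3
      _ ≤ _ := by
        rw [mul_comm]
        exact mul_le_mul_of_nonneg_right h2 hz.le
  refine ⟨B, (div_nonneg (tsum_nonneg fun p => spectralWeight_nonneg _ _ _ _ p)
    (tsum_exp_pos β (ε 0) (hZE 0)).le).trans (hB' 0), fun N E₁ E₂ => ?_⟩
  have hz := tsum_exp_pos β (ε N) (hZE N)
  rw [spectralSum, norm_div, tr_boltzmann, Complex.norm_real, Real.norm_eq_abs, abs_of_pos hz]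
  have h4 := tsum_of_norm_bounded ((summable_spectralWeight (hl N n) (hl N m) (hlvar N n)
    (hlvar N m)).mul_left (shiftBound β E₁ E₂)).hasSum
    fun p => norm_mul_mul_boltzmannConv_le hβ (ε N) (l N n) (hl N m) E₁ E₂ p
  rw [tsum_mul_left] at h4
  refine (div_le_div_of_nonneg_right h4 hz.le).trans ?_
  rw [mul_div_assoc]
  exact mul_le_mul_of_nonneg_left (hB' N) (shiftBound_nonneg hβ _ _)

/-- The reservoir limit may be taken under the sum over intermediate system levels. -/
theorem tendsto_tsum_spectralSum [Fintype J] (hβ : 0 < β)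
    (hZS : Summable fun i => Real.exp (-(β * ω i)))
    (hL : ∀ n, (L n).IsHermitian) (hLdom : ∀ n j, Summable fun k => ‖L n k j‖ ^ 2)
    (hZE : ∀ N, Summable fun μ => Real.exp (-(β * ε N μ)))
    (hl : ∀ N n, (l N n).IsHermitian)
    (hlvar : ∀ N n, Summable fun p : κ N × κ N =>
      Real.exp (-(β * ε N p.1)) * ‖l N n p.1 p.2‖ ^ 2)
    (hαlim : ∀ n m t s, Tendsto
      (fun N => envCorr β (ε N) (l N n) (l N m) t s) atTop (𝓝 (α n m (t - s))))
    (hαdecay : ∀ n m, Integrable (α n m)) (i j : ι) (d : ℂ) :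
    Tendsto (fun N => ∑' k, ∑ n, ∑ m, L n i k * L m k j *
        ((spectralSum β (ε N) (l N n) (l N m) (ω i) (ω k) -
          spectralSum β (ε N) (l N n) (l N m) (ω j) (ω k)) / d)) atTop
      (𝓝 (∑' k, ∑ n, ∑ m, L n i k * L m k j *
        ((lateSpectral β α n m (ω i) (ω k) - lateSpectral β α n m (ω j) (ω k)) / d))) := by
  choose B hB0 hB using exists_norm_spectralSum_le hβ hZE hl hlvar hαlim
  set C : ℝ → ℝ := fun e =>
    (β + 1) * (Real.exp (-(β * e)) + ∑' i, Real.exp (-(β * ω i))) with hC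
  have hS : ∀ N n m e k, ‖spectralSum β (ε N) (l N n) (l N m) e (ω k)‖ ≤ C e * B n m :=
    fun N n m e k => (hB n m N e (ω k)).trans
      (mul_le_mul_of_nonneg_right (shiftBound_le hβ hZS e k) (hB0 n m))
  refine tendsto_tsum_of_dominated_convergence
    (bound := fun k => ∑ n, ∑ m, ‖L n i k * L m k j‖ *
      ((C (ω i) * B n m + C (ω j) * B n m) / ‖d‖)) ?_ ?_ ?_
  · exact summable_sum fun n _ => summable_sum fun m _ =>
      (summable_norm_mul_apply hL hLdom n m i j).mul_right _
  · intro k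
    refine tendsto_finsetSum _ fun n _ => tendsto_finsetSum _ fun m _ => ?_
    exact (((tendsto_spectralSum hβ hZE hl hlvar hαlim hαdecay n m (ω i) (ω k)).sub
      (tendsto_spectralSum hβ hZE hl hlvar hαlim hαdecay n m (ω j) (ω k))).div_const
        d).const_mul _
  · refine Eventually.of_forall fun N k => ?_
    refine (norm_sum_le _ _).trans (Finset.sum_le_sum fun n _ => (norm_sum_le _ _).trans
      (Finset.sum_le_sum fun m _ => ?_))
    rw [norm_mul, norm_div]
    exact mul_le_mul_of_nonneg_left (div_le_div_of_nonneg_right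
      ((norm_sub_le _ _).trans (add_le_add (hS _ _ _ _ _) (hS _ _ _ _ _))) (norm_nonneg _))
      (norm_nonneg _)

end Convergence

/-! ### Quotients of power series -/

section Quotient

variable (a b : ℕ → ℂ)

/-- The coefficients of a quotient of power series, up to the second, solve the triangular
system of the product. -/
lemma coeff_mk_mul_inv (hb : b 0 ≠ 0) :
    let r := fun k => (PowerSeries.mk a * (PowerSeries.mk b)⁻¹).coeff k
    r 0 * b 0 = a 0 ∧ r 0 * b 1 + r 1 * b 0 = a 1 ∧
      r 0 * b 2 + r 1 * b 1 + r 2 * b 0 = a 2 := by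
  intro r
  have h : PowerSeries.mk a * (PowerSeries.mk b)⁻¹ * PowerSeries.mk b = PowerSeries.mk a := by
    rw [mul_assoc, PowerSeries.inv_mul_cancel _ (by simpa using hb), mul_one]
  have hk : ∀ k, ∑ q ∈ Finset.HasAntidiagonal.antidiagonal k, r q.1 * b q.2 = a k := by
    intro k
    have := congrArg (PowerSeries.coeff k) h
    rw [PowerSeries.coeff_mul] at this
    simpa only [PowerSeries.coeff_mk] using this
  refine ⟨?_, ?_, ?_⟩
  · simpa using hk 0
  · simpa [Finset.Nat.antidiagonal_succ] using hk 1
  · have := hk 2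
    simp [Finset.Nat.antidiagonal_succ] at this
    linear_combination this

/-- The Taylor polynomial of a quotient is that of the quotient of power series. -/
lemma isBigO_div_sub {A B : ℝ → ℂ} (hb : b 0 ≠ 0)
    (hA : (fun g : ℝ => A g - ∑ k ∈ Finset.range 3, a k * (g : ℂ) ^ k) =O[𝓝 0]
      fun g : ℝ => g ^ 3)
    (hB : (fun g : ℝ => B g - ∑ k ∈ Finset.range 3, b k * (g : ℂ) ^ k) =O[𝓝 0]
      fun g : ℝ => g ^ 3) :
    (fun g : ℝ => A g / B g - ∑ k ∈ Finset.range 3,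
      (PowerSeries.mk a * (PowerSeries.mk b)⁻¹).coeff k * (g : ℂ) ^ k) =O[𝓝 0]
      fun g : ℝ => g ^ 3 := by
  obtain ⟨h0, h1, h2⟩ := coeff_mk_mul_inv a b hb
  set r : ℕ → ℂ := fun k => (PowerSeries.mk a * (PowerSeries.mk b)⁻¹).coeff k with hr
  have hpoly : ∀ c : ℕ → ℂ, Continuous fun g : ℝ => ∑ k ∈ Finset.range 3, c k * (g : ℂ) ^ k :=
    fun c => by fun_prop
  have hBt : Tendsto B (𝓝 0) (𝓝 (b 0)) := by
    have e1 : Tendsto (fun g : ℝ => g ^ 3) (𝓝 0) (𝓝 0) := by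
      simpa using (continuous_pow 3 : Continuous fun g : ℝ => g ^ 3).tendsto 0
    have e2 := (hB.trans_tendsto e1).add ((hpoly b).tendsto 0)
    simpa [Finset.sum_range_succ] using e2
  have hr1 : (fun g : ℝ => ∑ k ∈ Finset.range 3, r k * (g : ℂ) ^ k) =O[𝓝 0]
      fun _ : ℝ => (1 : ℝ) := ((hpoly r).tendsto 0).isBigO_one ℝ
  have hBi : (fun g => (B g)⁻¹) =O[𝓝 0] fun _ : ℝ => (1 : ℝ) :=
    (hBt.inv₀ hb).isBigO_one ℝ
  have hrem : (fun g : ℝ => -((g : ℂ) ^ 3 * (r 1 * b 2 + r 2 * b 1 + r 2 * b 2 * g))) =O[𝓝 0]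
      fun g : ℝ => g ^ 3 := by
    have e1 : (fun g : ℝ => (g : ℂ) ^ 3) =O[𝓝 0] fun g : ℝ => g ^ 3 :=
      IsBigO.of_bound 1 (Eventually.of_forall fun g => by simp)
    have e2 : (fun g : ℝ => r 1 * b 2 + r 2 * b 1 + r 2 * b 2 * (g : ℂ)) =O[𝓝 0]
        fun _ : ℝ => (1 : ℝ) :=
      Tendsto.isBigO_one ℝ (Continuous.tendsto (by fun_prop) 0)
    simpa using (e1.mul e2).neg_left
  have hB' : (fun g : ℝ => (∑ k ∈ Finset.range 3, r k * (g : ℂ) ^ k) *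
      (B g - ∑ k ∈ Finset.range 3, b k * (g : ℂ) ^ k)) =O[𝓝 0] fun g : ℝ => g ^ 3 := by
    simpa using hr1.mul hB
  have hall := ((hA.sub hB').add hrem).mul hBi
  simp only [mul_one] at hall
  refine hall.congr' ?_ EventuallyEq.rfl
  filter_upwards [hBt.eventually_ne hb] with g hg
  rw [← div_eq_mul_inv, div_eq_iff hg, sub_mul, div_mul_cancel₀ _ hg]
  simp only [Finset.sum_range_succ, Finset.sum_range_zero, zero_add, pow_zero, mul_one, pow_one]
  linear_combination h0 + (g : ℂ) * h1 + (g : ℂ) ^ 2 * h2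

end Quotient

/-! ### The Dyson series of a finite-dimensional Gibbs operator -/

section Finite

variable {a : Type*} [Fintype a]

lemma mmul_eq_mul (X Y : Matrix a a ℂ) : mmul X Y = X * Y := by
  ext i j
  rw [mmul, tsum_fintype, Matrix.mul_apply]

variable [DecidableEq a]

lemma exp_neg_smul_eq (t : ℝ) (M : Matrix a a ℂ) :
    NormedSpace.exp (-((t : ℂ) • M)) = NormedSpace.exp (t • (-M)) := by
  congr 1
  ext x y
  simp

open scoped Matrix.Norms.Operator in
lemma hasDerivAt_exp_neg_smul (M : Matrix a a ℂ) (t : ℝ) (x y : a) :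
    HasDerivAt (fun s : ℝ => NormedSpace.exp (-((s : ℂ) • M)) x y)
      (-(M * NormedSpace.exp (-((t : ℂ) • M))) x y) t := by
  simp_rw [exp_neg_smul_eq]
  have h := hasDerivAt_exp_smul_const' (𝕂 := ℝ) (-M) t
  have h1 := hasDerivAt_pi.1 (hasDerivAt_pi.1 h x) y
  rw [neg_mul] at h1
  exact h1

open scoped Matrix.Norms.Operator in
lemma continuous_exp_neg_smul (M V : Matrix a a ℂ) (x y : a) :
    Continuous fun q : ℝ × ℝ => NormedSpace.exp (-((q.2 : ℂ) • (M + (q.1 : ℂ) • V))) x y := by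
  have h1 : Continuous fun q : ℝ × ℝ => -((q.2 : ℂ) • (M + (q.1 : ℂ) • V)) := by fun_prop
  have h2 : Continuous fun q : ℝ × ℝ =>
      NormedSpace.exp (-((q.2 : ℂ) • (M + (q.1 : ℂ) • V))) :=
    NormedSpace.exp_continuous.comp h1
  exact (continuous_apply y).comp ((continuous_apply x).comp h2)

variable (E : a → ℝ) (V : Matrix a a ℂ)

/-- Duhamel's formula. -/
lemma exp_eq_boltzmann_sub_integral (g t : ℝ) (x y : a) :
    NormedSpace.exp (-((t : ℂ) • (ham E + (g : ℂ) • V))) x y = boltzmann E t x y -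
      g * ∫ s in (0 : ℝ)..t, (Real.exp (-((t - s) * E x)) : ℂ) *
        (V * NormedSpace.exp (-((s : ℂ) • (ham E + (g : ℂ) • V)))) x y := by
  set T : ℝ → Matrix a a ℂ := fun s => NormedSpace.exp (-((s : ℂ) • (ham E + (g : ℂ) • V)))
    with hT
  have hTc : ∀ x y, Continuous fun s => T s x y := fun x y =>
    continuous_iff_continuousAt.2 fun s =>
      (hasDerivAt_exp_neg_smul (ham E + (g : ℂ) • V) s x y).continuousAt
  have hd : ∀ s ∈ Set.uIcc 0 t, HasDerivAt
      (fun s : ℝ => (Real.exp (-((t - s) * E x)) : ℂ) * T s x y)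
      (-(g : ℂ) * ((Real.exp (-((t - s) * E x)) : ℂ) * (V * T s) x y)) s := by
    intro s _
    refine HasDerivAt.congr_deriv ((hasDerivAt_exp_neg_sub_mul t (E x) s).ofReal_comp.mul
      (hasDerivAt_exp_neg_smul (ham E + (g : ℂ) • V) s x y)) ?_
    rw [add_mul, Matrix.add_apply, Matrix.smul_mul, Matrix.smul_apply, ham,
      Matrix.diagonal_mul, smul_eq_mul]
    simp only [hT, ham]
    push_cast
    ring
  have hcont : Continuous fun s : ℝ => (Real.exp (-((t - s) * E x)) : ℂ) * (V * T s) x y := by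
    simp only [Matrix.mul_apply]
    have := hTc
    fun_prop
  have h := intervalIntegral.integral_eq_sub_of_hasDerivAt hd
    ((continuous_const.mul hcont).intervalIntegrable _ _)
  rw [intervalIntegral.integral_const_mul] at h
  have hT0 : T 0 = 1 := by simp [hT]
  rw [hT0] at h
  have h0 : (Real.exp (-((t - 0) * E x)) : ℂ) * (1 : Matrix a a ℂ) x y = boltzmann E t x y := by
    by_cases hxy : x = y
    · subst hxy; simp [boltzmann]
    · simp [boltzmann, hxy]
  rw [h0] at h
  simp only [sub_self, zero_mul, neg_zero, Real.exp_zero, Complex.ofReal_one, one_mul] at h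
  linear_combination -h

lemma continuous_dyson (k : ℕ) (x y : a) : Continuous fun t => dyson E V k t x y := by
  induction k generalizing x y with
  | zero =>
    simp only [dyson, boltzmann, Matrix.diagonal_apply]
    split_ifs <;> fun_prop
  | succ k ih =>
    have h : ∀ t, dyson E V (k + 1) t x y = -((Real.exp (-(t * E x)) : ℂ) *
        ∫ s in (0 : ℝ)..t, (Real.exp (s * E x) : ℂ) * (V * dyson E V k s) x y) := by
      intro t
      have h3 : dyson E V (k + 1) t x y = -∫ s in (0 : ℝ)..t,
        (Real.exp (-((t - s) * E x)) : ℂ) * mmul V (dyson E V k s) x y := rfl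
      rw [h3, ← intervalIntegral.integral_const_mul]
      congr 2; ext s
      rw [← mul_assoc, ← Complex.ofReal_mul, ← Real.exp_add, mmul_eq_mul]
      congr 3; ring_nf
    simp_rw [h]
    have hc : Continuous fun s : ℝ => (Real.exp (s * E x) : ℂ) * (V * dyson E V k s) x y := by
      simp only [Matrix.mul_apply]
      fun_prop
    have hp := intervalIntegral.continuous_primitive (μ := volume)
      (fun u v => hc.intervalIntegrable u v) 0
    fun_prop

/-- The remainder of the Dyson series after `n` terms. -/
def dysonRemainder (n : ℕ) (g t : ℝ) (x y : a) : ℂ :=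
  NormedSpace.exp (-((t : ℂ) • (ham E + (g : ℂ) • V))) x y -
    ∑ k ∈ Finset.range n, dyson E V k t x y * (g : ℂ) ^ k

lemma dysonRemainder_succ (n : ℕ) (g t : ℝ) (x y : a) :
    dysonRemainder E V (n + 1) g t x y = -(g * ∫ s in (0 : ℝ)..t,
      (Real.exp (-((t - s) * E x)) : ℂ) * ∑ z, V x z * dysonRemainder E V n g s z y) := by
  have hTc : ∀ x y, Continuous fun t : ℝ =>
      NormedSpace.exp (-((t : ℂ) • (ham E + (g : ℂ) • V))) x y := fun x y =>
    (continuous_exp_neg_smul (ham E) V x y).comp (continuous_const.prodMk continuous_id)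
  have hduhamel := exp_eq_boltzmann_sub_integral E V g t x y
  simp only [dysonRemainder]
  obtain ⟨T, hT⟩ : ∃ T : ℝ → Matrix a a ℂ, ∀ s : ℝ,
      NormedSpace.exp (-((s : ℂ) • (ham E + (g : ℂ) • V))) = T s := ⟨_, fun _ => rfl⟩
  simp only [hT] at hTc hduhamel ⊢
  have hDc := continuous_dyson E V
  have hD : ∀ k, dyson E V (k + 1) t x y = -∫ s in (0 : ℝ)..t,
      (Real.exp (-((t - s) * E x)) : ℂ) * ∑ z, V x z * dyson E V k s z y := by
    intro k
    have h3 : dyson E V (k + 1) t x y = -∫ s in (0 : ℝ)..t,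
      (Real.exp (-((t - s) * E x)) : ℂ) * mmul V (dyson E V k s) x y := rfl
    rw [h3]
    simp only [mmul_eq_mul, Matrix.mul_apply]
  have hVT : Continuous fun s : ℝ =>
      (Real.exp (-((t - s) * E x)) : ℂ) * ∑ z, V x z * T s z y := by
    fun_prop
  have hVD : ∀ k, Continuous fun s : ℝ =>
      ((Real.exp (-((t - s) * E x)) : ℂ) * ∑ z, V x z * dyson E V k s z y) * (g : ℂ) ^ k := by
    intro k
    have := hDc k
    fun_prop
  have hsplit : ∀ s : ℝ, (Real.exp (-((t - s) * E x)) : ℂ) *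
      ∑ z, V x z * (T s z y - ∑ k ∈ Finset.range n, dyson E V k s z y * (g : ℂ) ^ k) =
      (Real.exp (-((t - s) * E x)) : ℂ) * ∑ z, V x z * T s z y -
      ∑ k ∈ Finset.range n, ((Real.exp (-((t - s) * E x)) : ℂ) *
        ∑ z, V x z * dyson E V k s z y) * (g : ℂ) ^ k := by
    intro s
    simp only [mul_sub, Finset.sum_sub_distrib]
    congr 1
    simp only [Finset.mul_sum, Finset.sum_mul]
    rw [Finset.sum_comm]
    refine Finset.sum_congr rfl fun k _ => Finset.sum_congr rfl fun z _ => ?_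
    ring
  simp_rw [hsplit]
  rw [intervalIntegral.integral_sub (hVT.intervalIntegrable _ _)
      ((continuous_finsetSum _ fun k _ => hVD k).intervalIntegrable _ _),
    intervalIntegral.integral_finsetSum fun k _ => (hVD k).intervalIntegrable _ _]
  simp_rw [intervalIntegral.integral_mul_const]
  have h0 : dyson E V 0 t x y = boltzmann E t x y := rfl
  rw [hduhamel, Finset.sum_range_succ', h0]
  simp only [Matrix.mul_apply, hD, pow_zero, mul_one, pow_succ]
  generalize (∫ s in (0 : ℝ)..t, (Real.exp (-((t - s) * E x)) : ℂ) * ∑ z, V x z * T s z y) = I₁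
  have : ∑ k ∈ Finset.range n, -(∫ s in (0 : ℝ)..t, (Real.exp (-((t - s) * E x)) : ℂ) *
        ∑ z, V x z * dyson E V k s z y) * ((g : ℂ) ^ k * g) =
      -(g * ∑ k ∈ Finset.range n, (∫ s in (0 : ℝ)..t, (Real.exp (-((t - s) * E x)) : ℂ) *
        ∑ z, V x z * dyson E V k s z y) * (g : ℂ) ^ k) := by
    rw [Finset.mul_sum, ← Finset.sum_neg_distrib]
    exact Finset.sum_congr rfl fun k _ => by ring
  rw [this]
  ring

/-- The remainder after `n` terms is of order `g ^ n`, uniformly in imaginary time. -/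
lemma exists_norm_dysonRemainder_le (β : ℝ) (hβ : 0 < β) (n : ℕ) :
    ∃ C, 0 ≤ C ∧ ∀ g ∈ Set.Icc (-1 : ℝ) 1, ∀ t ∈ Set.Icc 0 β, ∀ x y,
      ‖dysonRemainder E V n g t x y‖ ≤ C * |g| ^ n := by
  induction n with
  | zero =>
    have h : ∀ x y, ∃ C, ∀ q ∈ Set.Icc (-1 : ℝ) 1 ×ˢ Set.Icc (0 : ℝ) β,
        ‖NormedSpace.exp (-((q.2 : ℂ) • (ham E + (q.1 : ℂ) • V))) x y‖ ≤ C := fun x y =>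
      (isCompact_Icc.prod isCompact_Icc).exists_bound_of_continuousOn
        (continuous_exp_neg_smul (ham E) V x y).continuousOn
    choose C hC using h
    refine ⟨∑ x, ∑ y, |C x y|, by positivity, fun g hg t ht x y => ?_⟩
    simp only [dysonRemainder, Finset.range_zero, Finset.sum_empty, sub_zero, pow_zero, mul_one]
    refine (hC x y (g, t) ⟨hg, ht⟩).trans ((le_abs_self _).trans ?_)
    exact (Finset.single_le_sum (f := fun y => |C x y|) (fun _ _ => abs_nonneg _)
      (Finset.mem_univ y)).trans (Finset.single_le_sum (f := fun x => ∑ y, |C x y|)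
        (fun _ _ => Finset.sum_nonneg fun _ _ => abs_nonneg _) (Finset.mem_univ x))
  | succ n ih =>
    obtain ⟨C, hC0, hC⟩ := ih
    set M : ℝ := 1 + ∑ z, Real.exp (-(β * E z)) with hM
    set W : ℝ := ∑ x, ∑ z, ‖V x z‖ with hW
    have hM0 : 0 ≤ M := by positivity
    have hW0 : 0 ≤ W := by positivity
    refine ⟨M * (W * C) * β, by positivity, fun g hg t ht x y => ?_⟩
    rw [dysonRemainder_succ, norm_neg, norm_mul, Complex.norm_real, Real.norm_eq_abs]
    have hb : ∀ s ∈ Set.uIoc 0 t, ‖(Real.exp (-((t - s) * E x)) : ℂ) *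
        ∑ z, V x z * dysonRemainder E V n g s z y‖ ≤ M * (W * (C * |g| ^ n)) := by
      intro s hs
      rw [Set.uIoc_of_le ht.1] at hs
      rw [norm_mul, Complex.norm_real, Real.norm_eq_abs, abs_of_pos (Real.exp_pos _)]
      refine mul_le_mul ?_ ?_ (norm_nonneg _) hM0
      · refine (exp_neg_mul_le_one_add (by linarith [hs.2]) (t := β)
          (by linarith [hs.1, ht.2]) _).trans (add_le_add le_rfl ?_)
        exact Finset.single_le_sum (f := fun z => Real.exp (-(β * E z)))
          (fun _ _ => (Real.exp_pos _).le) (Finset.mem_univ x)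
      · refine (norm_sum_le _ _).trans ?_
        have h1 : ∑ z, ‖V x z‖ ≤ W :=
          Finset.single_le_sum (f := fun x => ∑ z, ‖V x z‖)
            (fun _ _ => Finset.sum_nonneg fun _ _ => norm_nonneg _) (Finset.mem_univ x)
        refine le_trans (Finset.sum_le_sum fun z _ => ?_)
          ((Finset.sum_mul _ _ _).symm.le.trans
            (mul_le_mul_of_nonneg_right h1 (by positivity)))
        rw [norm_mul]
        exact mul_le_mul_of_nonneg_left (hC g hg s ⟨hs.1.le, hs.2.trans ht.2⟩ z y)
          (norm_nonneg _)
    have h2 := intervalIntegral.norm_integral_le_of_norm_le_const hb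
    rw [sub_zero, abs_of_nonneg ht.1] at h2
    calc |g| * _ ≤ |g| * (M * (W * (C * |g| ^ n)) * β) :=
          mul_le_mul_of_nonneg_left (h2.trans
            (mul_le_mul_of_nonneg_left ht.2 (by positivity))) (abs_nonneg _)
      _ = _ := by ring

lemma isBigO_exp_sub_dyson (β : ℝ) (hβ : 0 < β) (n : ℕ) (x y : a) :
    (fun g : ℝ => NormedSpace.exp (-((β : ℂ) • (ham E + (g : ℂ) • V))) x y -
      ∑ k ∈ Finset.range n, dyson E V k β x y * (g : ℂ) ^ k) =O[𝓝 0] fun g : ℝ => g ^ n := by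
  obtain ⟨C, -, hC⟩ := exists_norm_dysonRemainder_le E V β hβ n
  refine IsBigO.of_bound C ?_
  filter_upwards [Icc_mem_nhds (by norm_num : (-1 : ℝ) < 0) (by norm_num : (0 : ℝ) < 1)] with g hg
  rw [norm_pow, Real.norm_eq_abs]
  exact hC g hg β ⟨hβ.le, le_rfl⟩ x y

end Finite

section FiniteReduced

variable {ι κ J : Type*} [DecidableEq ι] [DecidableEq κ] [Fintype J]
  (ω : ι → ℝ) (ε : κ → ℝ) (L : J → Matrix ι ι ℂ) (l : J → Matrix κ κ ℂ)

lemma closedHam_eq (g : ℝ) : closedHam ω ε L l g =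
    ham (fun x : ι × κ => ω x.1 + ε x.2) + (g : ℂ) • interaction L l := by
  rw [closedHam]
  congr 1
  ext ⟨i, μ⟩ ⟨j, ν⟩
  simp only [Matrix.add_apply, ham, Matrix.diagonal_apply, Prod.mk.injEq]
  by_cases h1 : i = j <;> by_cases h2 : μ = ν <;> simp [h1, h2]

variable [Fintype ι] [Fintype κ]

/-- Finite sums of matrix elements of the Gibbs operator have the summed Dyson coefficients as
their Taylor coefficients. -/
lemma isBigO_sum_exp_closedHam (β : ℝ) (hβ : 0 < β) {s : Type*} [Fintype s] (x y : s → ι × κ) :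
    (fun g : ℝ => ∑ q, NormedSpace.exp (-((β : ℂ) • closedHam ω ε L l g)) (x q) (y q) -
      ∑ k ∈ Finset.range 3, (∑ q, closedGibbs β ω ε L l k (x q) (y q)) * (g : ℂ) ^ k)
      =O[𝓝 0] fun g : ℝ => g ^ 3 := by
  have h := IsBigO.sum (s := Finset.univ) fun (q : s) _ =>
    isBigO_exp_sub_dyson (fun x : ι × κ => ω x.1 + ε x.2) (interaction L l) β hβ 3 (x q) (y q)
  refine h.congr_left fun g => ?_
  simp only [closedHam_eq, closedGibbs, Finset.sum_mul, Finset.sum_apply,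
    Finset.sum_sub_distrib]
  rw [Finset.sum_comm]

theorem isBigO_reducedThermal_sub [Nonempty κ] (β : ℝ) (hβ : 0 < β) (i j : ι) :
    (fun g : ℝ => reducedThermal β ω ε L l g i j - ∑ k ∈ Finset.range 3,
      (reducedThermalSeries β ω ε L l i j).coeff k * (g : ℂ) ^ k) =O[𝓝 0]
      fun g : ℝ => g ^ 3 := by
  have : Nonempty ι := ⟨i⟩
  refine isBigO_div_sub (fun k => trEnv (closedGibbs β ω ε L l k) i j)
    (fun k => tr (closedGibbs β ω ε L l k)) ?_ ?_ ?_
  · have h1 : Summable fun i => Real.exp (-(β * ω i)) := (hasSum_fintype _).summable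
    have h2 : Summable fun μ => Real.exp (-(β * ε μ)) := (hasSum_fintype _).summable
    rw [tr_closedGibbs_zero h1 h2, tr_boltzmann, tr_boltzmann]
    exact_mod_cast (mul_pos (tsum_exp_pos β ω h1) (tsum_exp_pos β ε h2)).ne'
  · simp only [trEnv, tsum_fintype]
    exact isBigO_sum_exp_closedHam ω ε L l β hβ (fun μ : κ => (i, μ)) fun μ => (j, μ)
  · simp only [tr, tsum_fintype]
    exact isBigO_sum_exp_closedHam ω ε L l β hβ (fun q : ι × κ => q) fun q => q

end FiniteReduced

/-! ### Coefficients of the reduced thermal state and stationary corrections -/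

section Coefficients

variable {ι κ J : Type*} [DecidableEq ι] [Fintype J]
  {β : ℝ} {ω : ι → ℝ} {ε : κ → ℝ} {L : J → Matrix ι ι ℂ} {l : J → Matrix κ κ ℂ}

lemma coeff_reducedThermalSeries [DecidableEq κ] [Nonempty κ]
    (hZS : Summable fun i => Real.exp (-(β * ω i)))
    (hZE : Summable fun μ => Real.exp (-(β * ε μ)))
    (hlvar : ∀ n, Summable fun p : κ × κ => Real.exp (-(β * ε p.1)) * ‖l n p.1 p.2‖ ^ 2)
    (hlmean : ∀ n, thermalMean β ε (l n) = 0) (i j : ι) :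
    (reducedThermalSeries β ω ε L l i j).coeff 0 = thermal β ω i j ∧
      (reducedThermalSeries β ω ε L l i j).coeff 1 = 0 ∧
      (i ≠ j → (reducedThermalSeries β ω ε L l i j).coeff 2 =
        trEnv (closedGibbs β ω ε L l 2) i j / (tr (boltzmann ω β) * tr (boltzmann ε β))) := by
  have : Nonempty ι := ⟨i⟩
  have hS := tr_boltzmann_ne_zero hZS
  have hE := tr_boltzmann_ne_zero hZE
  have hb := tr_closedGibbs_zero (L := L) (l := l) hZS hZE
  have hb1 := tr_closedGibbs_one (ω := ω) (L := L) hZE hlvar hlmean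
  have ha := trEnv_closedGibbs_zero (β := β) (ω := ω) (ε := ε) (L := L) (l := l) i j
  have ha1 := trEnv_closedGibbs_one (ω := ω) (L := L) hZE hlvar hlmean i j
  obtain ⟨h0, h1, h2⟩ := coeff_mk_mul_inv
    (fun k => trEnv (closedGibbs β ω ε L l k) i j) (fun k => tr (closedGibbs β ω ε L l k))
    (by rw [hb]; exact mul_ne_zero hS hE)
  change (reducedThermalSeries β ω ε L l i j).coeff 0 * _ = _ at h0
  change (reducedThermalSeries β ω ε L l i j).coeff 0 * _ +
    (reducedThermalSeries β ω ε L l i j).coeff 1 * _ = _ at h1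
  change (reducedThermalSeries β ω ε L l i j).coeff 0 * _ +
    (reducedThermalSeries β ω ε L l i j).coeff 1 * _ +
    (reducedThermalSeries β ω ε L l i j).coeff 2 * _ = _ at h2
  rw [hb, ha] at h0
  rw [hb1, hb, ha1, mul_zero, zero_add] at h1
  have e0 : (reducedThermalSeries β ω ε L l i j).coeff 0 = thermal β ω i j := by
    rw [thermal, eq_div_iff hS]
    refine mul_right_cancel₀ hE ?_
    rw [mul_assoc, h0]
  have e1 := (mul_eq_zero.1 h1).resolve_right (mul_ne_zero hS hE)
  refine ⟨e0, e1, fun hij => ?_⟩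
  rw [e0, e1, thermal_eq_diagonal, Matrix.diagonal_apply_ne _ hij, hb, zero_mul, zero_mul,
    zero_add, zero_add] at h2
  rw [eq_div_iff (mul_ne_zero hS hE), h2]

lemma apply_of_isSecondOrderStationary (hω : Function.Injective ω) {α : J → J → ℝ → ℂ}
    {ρ₀ ρ₂ : Matrix ι ι ℂ} (h : IsSecondOrderStationary ω L α ρ₀ ρ₂) {i j : ι} (hij : i ≠ j) :
    ρ₂ i j = -Complex.I * lateLiouville2 ω L α ρ₀ i j / ((ω i : ℂ) - ω j) := by
  have hd : (ω i : ℂ) - ω j ≠ 0 := sub_ne_zero.2 (by exact_mod_cast hω.ne hij)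
  have h1 := congrFun (congrFun h.2 i) j
  rw [Matrix.add_apply, liouville0_apply, Matrix.zero_apply] at h1
  rw [eq_div_iff hd]
  linear_combination Complex.I * h1 + ((ω i : ℂ) - ω j) * ρ₂ i j * Complex.I_mul_I

/-- A stationary correction exists as soon as the second-order dynamics does not move the
populations, since `𝓛₀` is invertible off the diagonal. -/
lemma exists_isSecondOrderStationary (hω : Function.Injective ω) {α : J → J → ℝ → ℂ}
    (hdiag : ∀ i, lateLiouville2 ω L α (thermal β ω) i i = 0) :
    ∃ ρ₂, IsSecondOrderStationary ω L α (thermal β ω) ρ₂ := by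
  -- on the diagonal the quotient is the junk value `0`
  obtain ⟨ρ₂, hρ₂⟩ : ∃ ρ₂ : Matrix ι ι ℂ, ∀ i j, ρ₂ i j =
      -Complex.I * lateLiouville2 ω L α (thermal β ω) i j / ((ω i : ℂ) - ω j) :=
    ⟨_, fun _ _ => rfl⟩
  refine ⟨ρ₂, ?_, ?_⟩
  · ext i j
    rw [liouville0_apply, thermal_eq_diagonal, Matrix.zero_apply]
    by_cases hij : i = j
    · simp [hij]
    · simp [Matrix.diagonal_apply_ne _ hij]
  · ext i j
    rw [Matrix.add_apply, liouville0_apply, Matrix.zero_apply]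
    by_cases hij : i = j
    · subst hij
      simp [hdiag]
    · have hd : (ω i : ℂ) - ω j ≠ 0 := sub_ne_zero.2 (by exact_mod_cast hω.ne hij)
      rw [hρ₂, mul_div_cancel₀ _ hd]
      linear_combination lateLiouville2 ω L α (thermal β ω) i j * Complex.I_mul_I

end Coefficients

end OpenSystem

end

theorem mainTheorem5 {ι J : Type*} {κ : ℕ → Type*} [DecidableEq ι] [Fintype J]
    [∀ N, DecidableEq (κ N)] [∀ N, Nonempty (κ N)]
    (β : ℝ) (hβ : 0 < β)
    -- the system: non-degenerate levels, a Boltzmann state, Hermitian couplings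
    -- whose domains contain the energy eigenstates
    (ω : ι → ℝ) (hω : Function.Injective ω) (hZS : Summable fun i => Real.exp (-(β * ω i)))
    (L : J → Matrix ι ι ℂ) (hL : ∀ n, (L n).IsHermitian)
    (hLdom : ∀ n j, Summable fun k => ‖L n k j‖ ^ 2)
    -- the approximants of the reservoir, with centred Hermitian couplings of finite variance
    (ε : ∀ N, κ N → ℝ) (hZE : ∀ N, Summable fun μ => Real.exp (-(β * ε N μ)))
    (l : ∀ N, J → Matrix (κ N) (κ N) ℂ) (hl : ∀ N n, (l N n).IsHermitian)
    (hlvar : ∀ N n, Summable fun p : κ N × κ N =>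
      Real.exp (-(β * ε N p.1)) * ‖l N n p.1 p.2‖ ^ 2)
    (hlmean : ∀ N n, OpenSystem.thermalMean β (ε N) (l N n) = 0)
    -- the correlation functions of the infinite reservoir, which decay
    (α : J → J → ℝ → ℂ) (hαcont : ∀ n m, Continuous (α n m))
    (hαlim : ∀ n m t s, Tendsto
      (fun N => OpenSystem.envCorr β (ε N) (l N n) (l N m) t s) atTop (𝓝 (α n m (t - s))))
    (hαdecay : ∀ n m, Integrable (α n m)) :
    -- the second-order operators of the master equation reach their late-time form
    (∀ n m i k, Tendsto (fun t => OpenSystem.diamond ω (α n m) (L m) t i k) atTop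
      (𝓝 (OpenSystem.lateDiamond ω (α n m) (L m) i k))) ∧
    -- multivariate KMS relations
    (∀ n m (w : ℝ),
      OpenSystem.fourierT (α n m) w =
        OpenSystem.fourierT (α m n) (-w) * (Real.exp (-(β * w)) : ℂ) ∧
      OpenSystem.fourierT (α m n) (-w) =
        (starRingEnd ℂ) (OpenSystem.fourierT (α n m) (-w))) ∧
    -- the thermal state extends to a stationary state of second order
    (∃ ρ₂ : Matrix ι ι ℂ,
      OpenSystem.IsSecondOrderStationary ω L α (OpenSystem.thermal β ω) ρ₂) ∧
    -- in the closed system, orders zero and one are the thermal state and zero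
    (∀ N i j,
      (OpenSystem.reducedThermalSeries β ω (ε N) L (l N) i j).coeff 0 =
        OpenSystem.thermal β ω i j ∧
      (OpenSystem.reducedThermalSeries β ω (ε N) L (l N) i j).coeff 1 = 0) ∧
    -- off-diagonal second order: master equation and closed system agree
    (∀ ρ₂ : Matrix ι ι ℂ,
      OpenSystem.IsSecondOrderStationary ω L α (OpenSystem.thermal β ω) ρ₂ →
      ∀ i j, i ≠ j →
        ρ₂ i j = -Complex.I *
          OpenSystem.lateLiouville2 ω L α (OpenSystem.thermal β ω) i j / ((ω i : ℂ) - ω j) ∧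
        Tendsto (fun N => (OpenSystem.reducedThermalSeries β ω (ε N) L (l N) i j).coeff 2)
          atTop (𝓝 (ρ₂ i j))) ∧
    -- for finite-dimensional closed systems the series is that of the matrix exponential
    (∀ [Fintype ι] (N : ℕ) [Fintype (κ N)] (i j : ι),
      (fun g : ℝ => OpenSystem.reducedThermal β ω (ε N) L (l N) g i j -
        ∑ k ∈ Finset.range 3,
          (OpenSystem.reducedThermalSeries β ω (ε N) L (l N) i j).coeff k * (g : ℂ) ^ k)
        =O[𝓝 0] fun g : ℝ => g ^ 3) := by
  have hkms := OpenSystem.lateSpectral_eq_neg hβ hZE hl hlvar hαlim hαdecay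
  have hL2 := OpenSystem.lateLiouville2_thermal (ω := ω) (L := L) hZS hL hLdom hαdecay hkms
  refine ⟨fun n m i k => OpenSystem.tendsto_diamond (hαdecay n m) ω (L m) i k,
    fun n m w => ⟨OpenSystem.fourierT_kms hβ hZE hl hlvar hαlim hαdecay n m w,
      OpenSystem.fourierT_conj (OpenSystem.limitCorr_neg hZE hl hlvar hαlim) n m (-w)⟩,
    OpenSystem.exists_isSecondOrderStationary hω fun i => by rw [hL2]; simp,
    fun N i j => ?_, fun ρ₂ hρ₂ i j hij => ?_, ?_⟩
  · have h := OpenSystem.coeff_reducedThermalSeries (L := L) hZS (hZE N) (hlvar N) (hlmean N) i j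
    exact ⟨h.1, h.2.1⟩
  · have h := OpenSystem.apply_of_isSecondOrderStationary hω hρ₂ hij
    refine ⟨h, ?_⟩
    have : Nonempty ι := ⟨i⟩
    have hS := OpenSystem.tr_boltzmann_ne_zero hZS
    have hlim := (OpenSystem.tendsto_tsum_spectralSum (L := L) hβ hZS hL hLdom hZE hl hlvar hαlim
      hαdecay i j ((ω j : ℂ) - ω i)).div_const (OpenSystem.tr (OpenSystem.boltzmann ω β))
    have hval : ρ₂ i j = (∑' k, ∑ n, ∑ m, L n i k * L m k j *
        ((OpenSystem.lateSpectral β α n m (ω i) (ω k) -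
          OpenSystem.lateSpectral β α n m (ω j) (ω k)) / ((ω j : ℂ) - ω i))) /
        OpenSystem.tr (OpenSystem.boltzmann ω β) := by
      have hd : (ω i : ℂ) - ω j ≠ 0 := sub_ne_zero.2 (by exact_mod_cast hω.ne hij)
      have hd' : (ω j : ℂ) - ω i ≠ 0 := sub_ne_zero.2 (by exact_mod_cast hω.ne hij.symm)
      simp_rw [← mul_div_assoc, ← Finset.sum_div, tsum_div_const]
      rw [h, hL2]
      field_simp
      linear_combination (((ω j : ℂ) - ω i) * ∑' k, ∑ n, ∑ m, L n i k * L m k j *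
        (OpenSystem.lateSpectral β α n m (ω i) (ω k) -
          OpenSystem.lateSpectral β α n m (ω j) (ω k))) * Complex.I_mul_I
    rw [hval]
    refine hlim.congr fun N => ?_
    have hE := OpenSystem.tr_boltzmann_ne_zero (hZE N)
    rw [(OpenSystem.coeff_reducedThermalSeries hZS (hZE N) (hlvar N) (hlmean N) i j).2.2 hij,
      OpenSystem.trEnv_closedGibbs_two hβ hZS hL hLdom (hZE N) (hl N) (hlvar N) (hω.ne hij),
      mul_comm (OpenSystem.tr (OpenSystem.boltzmann ω β)), mul_div_mul_left _ _ hE]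
  · intro _ N _ i j
    exact OpenSystem.isBigO_reducedThermal_sub ω (ε N) L (l N) β hβ i j
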